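/- Let $F$ be the distribution function of a probability measure on $\mathbb{R}$, $\bar F = 1-F$, whose right tail is regularly varying with index $\gamma\ge 0$, i.e. $\lim_{x\to\infty}\bar F(xy)/\bar F(x)=y^{-\gamma}$ for every $y>0$, and let $Q_F(t)=\inf\{x\in\mathbb{R}: t\le F(x)\}$. Let $\Phi$ be the standard normal distribution function, let $n\ge 1$, and let $\omega_1,\dots,\omega_n\ge 0$ be fixed weights, not all zero (with the convention $0^\gamma=0$, also for $\gamma=0$). Put $\kappa=\sum_{j}\omega_j^\gamma$ and $\omega_{*,i}=\omega_i^\gamma/\kappa$. For p-values $P_1,\dots,P_n$ and a level $\alpha$, the weighted combination test $\phi_{\mathrm{wgt}}^{F,\omega}$ rejects ($\phi=1$) iff $$\sum_{i=1}^n\omega_i\,Q_F(1-P_i)>Q_F(1-\alpha/\kappa),$$ and the weighted Bonferroni test $\phi_{\mathrm{bon}}^{\omega_*}$ rejects iff $\min_i P_i/\omega_{*,i}<\alpha$ (where $P_i/0=\infty$); otherwise $\phi=0$. Fix means $\mu_1,\dots,\mu_n\in\mathbb{R}$ and $0\le\rho_0<1$. Let $\mathcal{M}$ be the set of all joint laws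 of $(T_1,\dots,T_n)$ such that $T_i\sim N(\mu_i,1)$ for every $i$ and, for all $i\ne j$, $(T_i,T_j)$ is bivariate normal with correlation $\rho_{ij}\in[-\rho_0,\rho_0]$. Theorem. For the two-sided p-values $P_i=2-2\Phi(|T_i|)$, $$\lim_{\alpha\to0^+}\ \sup_{\mathcal{M}}\ \frac{\Pr\left(\phi_{\mathrm{wgt}}^{F,\omega}\ne\phi_{\mathrm{bon}}^{\omega_*}\right)}{\min\left\{\Pr\left(\phi_{\mathrm{wgt}}^{F,\omega}=1\right),\ \Pr\left(\phi_{\mathrm{bon}}^{\omega_*}=1\right)\right\}}=0 .$$ If moreover $\bar F(x)\ge F(-x)$ for all sufficiently large $x$, then the same holds for the one-sided p-values $P_i=1-\Phi(T_i)$. -/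

import Mathlib

open MeasureTheory ProbabilityTheory Filter Topology
open scoped ENNReal

noncomputable section

namespace HeavyTail

/-- A distribution function `F` has a regularly varying (right) tail with tail index `γ ≥ 0`:
`(1 - F (x * y)) / (1 - F x) → y ^ (-γ)` as `x → ∞`, for every `y > 0`. -/
def RegularlyVaryingTail (F : ℝ → ℝ) (γ : ℝ) : Prop :=
  0 ≤ γ ∧ ∀ y : ℝ, 0 < y →
    Tendsto (fun x : ℝ => (1 - F (x * y)) / (1 - F x)) atTop (𝓝 (y ^ (-γ)))

/-- The quantile function `Q_F t = inf {x | t ≤ F x}`. For a distribution function `F`, the set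
is nonempty and bounded below whenever `0 < t < 1`. -/
def quantile (F : ℝ → ℝ) (t : ℝ) : ℝ := sInf {x : ℝ | t ≤ F x}

/-- The standard normal distribution function `Φ`. -/
def stdNormalCDF (x : ℝ) : ℝ := cdf (gaussianReal 0 1) x

/-- The two-sided p-value `2 - 2 Φ(|t|)`. -/
def twoSidedPValue (t : ℝ) : ℝ := 2 - 2 * stdNormalCDF |t|

/-- The one-sided p-value `1 - Φ(t)`. -/
def oneSidedPValue (t : ℝ) : ℝ := 1 - stdNormalCDF t

variable {n : ℕ}

/-- The `γ`-th power of a nonnegative weight, with the convention that a zero weight has power `0`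
also when `γ = 0` (a hypothesis of weight zero is ignored). It is `w ^ γ` for every `w > 0`. -/
def weightPow (γ w : ℝ) : ℝ := if w = 0 then 0 else w ^ γ

/-- `κ = ∑ i, ω i ^ γ`. -/
def kappa (γ : ℝ) (ω : Fin n → ℝ) : ℝ := ∑ i, weightPow γ (ω i)

/-- The weighted sum `∑ i, ω i * Q_F (1 - p i)` of the transformed p-values. -/
def weightedSum (F : ℝ → ℝ) (ω p : Fin n → ℝ) : ℝ := ∑ i, ω i * quantile F (1 - p i)

open Classical in
/-- Decision function (`1` = reject) of the weighted combination test at level `α`, applied to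
the p-values `p`: it rejects if the weighted sum exceeds `Q_F (1 - α / κ)`. -/
def combinationTest (F : ℝ → ℝ) (γ : ℝ) (ω : Fin n → ℝ) (α : ℝ) (p : Fin n → ℝ) : ℕ :=
  if quantile F (1 - α / kappa γ ω) < weightedSum F ω p then 1 else 0

open Classical in
/-- Decision function (`1` = reject) of the weighted Bonferroni test with weights `w` at level
`α`: it rejects if `min_i p i / w i < α`. The quotient is taken in `[0, ∞]`, so that a positive
p-value divided by a zero weight is `∞`. -/
def bonferroniTest (w : Fin n → ℝ) (α : ℝ) (p : Fin n → ℝ) : ℕ :=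
  if (⨅ i, ENNReal.ofReal (p i) / ENNReal.ofReal (w i)) < ENNReal.ofReal α then 1 else 0

/-- The normalized weights `ω i ^ γ / ∑ j, ω j ^ γ`. -/
def starWeights (γ : ℝ) (ω : Fin n → ℝ) (i : Fin n) : ℝ := weightPow γ (ω i) / kappa γ ω

/-- The correlation coefficient of two real random variables. -/
def correlation {Ω : Type*} [MeasurableSpace Ω] (X Y : Ω → ℝ) (P : Measure Ω) : ℝ :=
  cov[X, Y; P] / (√Var[X; P] * √Var[Y; P])

/-- `P` is the joint law of test statistics `T_1, …, T_n` (the coordinates of `Fin n → ℝ`) with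
`T_i ∼ N(μ_i, 1)`, with `(T_i, T_j)` bivariate normal for `i ≠ j`, and with all pairwise
correlations in `[-ρ₀, ρ₀]`. Nothing else is assumed about the joint law. -/
structure IsPairwiseNormalLaw (μ : Fin n → ℝ) (ρ₀ : ℝ) (P : Measure (Fin n → ℝ)) : Prop where
  isProbabilityMeasure : IsProbabilityMeasure P
  marginal : ∀ i, P.map (fun t => t i) = gaussianReal (μ i) 1
  pair : ∀ i j, i ≠ j → IsGaussian (P.map (fun t => (t i, t j)))
  abs_correlation_le : ∀ i j, i ≠ j → |correlation (fun t => t i) (fun t => t j) P| ≤ ρ₀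

/-- With the p-values `pval (T_i)`, the ratio, under the joint law `P`, of the probability that
the weighted combination test and the weighted Bonferroni test with the weights
`ω i ^ γ / ∑ j, ω j ^ γ` disagree, to the smaller of their two rejection probabilities. It is an
element of `[0, ∞]`, equal to `∞` if the denominator vanishes and the numerator does not. -/
def disagreementRatio (pval : ℝ → ℝ) (F : ℝ → ℝ) (γ : ℝ) (ω : Fin n → ℝ) (α : ℝ)
    (P : Measure (Fin n → ℝ)) : ℝ≥0∞ :=
  P {t | combinationTest F γ ω α (fun i => pval (t i)) ≠
      bonferroniTest (starWeights γ ω) α (fun i => pval (t i))} /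
    min (P {t | combinationTest F γ ω α (fun i => pval (t i)) = 1})
      (P {t | bonferroniTest (starWeights γ ω) α (fun i => pval (t i)) = 1})

/-- The two tests are asymptotically equivalent as `α → 0+`, uniformly over all joint laws of the
test statistics with the given means and with pairwise correlations in `[-ρ₀, ρ₀]`. -/
def AsymptoticallyEquivalent (pval : ℝ → ℝ) (F : ℝ → ℝ) (γ : ℝ) (ω μ : Fin n → ℝ) (ρ₀ : ℝ) :
    Prop :=
  Tendsto
    (fun α : ℝ => ⨆ P ∈ {P : Measure (Fin n → ℝ) | IsPairwiseNormalLaw μ ρ₀ P},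
      disagreementRatio pval F γ ω α P)
    (𝓝[>] 0) (𝓝 0)

end HeavyTail

end

namespace HeavyTail

/-! ### The standard normal tail -/

/-! A heavy-tailed sum exceeds a high level essentially when one term does, and regular variation
makes the event that the `i`-th term alone exceeds `x = Q_F(1 - α/κ)` nearly the event that `P_i` is
below its Bonferroni threshold `ω_{*,i} α`. Deterministically (`exists_eventually_of_ne`), for small
`α` the tests can disagree only if some `P_i` lies within a factor `1 ± ε` of its threshold, or two
p-values are `O(α)`, or some `P_i` is below its threshold while another p-value is at least `1 -
F(-c x)`, so that a large negative term can cancel the large positive one.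

Each such event has probability at most `η` times `P(P_i < ω_{*,i} α)`, hence at most `η` times the
Bonferroni rejection probability. The shell is thin relative to the rejection region because the
density of the p-value varies by a bounded factor over comparable small arguments
(`exists_gaussianReal_band_le`). Joint smallness is Gaussian tail independence: `Y - ρX` is
independent of `X` and would itself have to be large (`eventually_measure_joint_le`). For the
cancelling event, a two-sided p-value near `1` confines `Y` to a small ball, where its conditional
density given `X` is bounded (`IsNormalPair.measure_abs_le`); in the one-sided case the tail balance
condition turns it into joint smallness for `(X, -Y)`.

All bounds depend on the joint law only through the means and `ρ₀`, which gives uniformity. Once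
disagreement is negligible relative to one rejection probability, the other is comparable to it. -/

lemma oneSidedPValue_eq_real (x : ℝ) :
    oneSidedPValue x = (gaussianReal 0 1).real (Set.Ioi x) := by
  rw [oneSidedPValue, stdNormalCDF, cdf_eq_real, ← probReal_compl_eq_one_sub measurableSet_Iic,
    Set.compl_Iic]

lemma ofReal_oneSidedPValue (x : ℝ) :
    ENNReal.ofReal (oneSidedPValue x) = gaussianReal 0 1 (Set.Ioi x) := by
  rw [oneSidedPValue_eq_real, ofReal_measureReal]

lemma gaussianReal_pos_of_isOpen (m : ℝ) {U : Set ℝ} (hU : IsOpen U) (hne : U.Nonempty) :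
    0 < gaussianReal m 1 U := by
  rw [pos_iff_ne_zero]
  intro h
  exact (hU.measure_pos volume hne).ne' (gaussianReal_absolutelyContinuous' m one_ne_zero h)

instance : NullSingletonClass (gaussianReal 0 1) := nullSingletonClass_gaussianReal one_ne_zero

lemma oneSidedPValue_sub {x y : ℝ} (h : x ≤ y) :
    oneSidedPValue x - oneSidedPValue y = (gaussianReal 0 1).real (Set.Ioc x y) := by
  rw [oneSidedPValue_eq_real, oneSidedPValue_eq_real, ← Set.Ioc_union_Ioi_eq_Ioi h,
    measureReal_union (Set.Ioc_disjoint_Ioi le_rfl) measurableSet_Ioi]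
  ring

lemma strictAnti_oneSidedPValue : StrictAnti oneSidedPValue := by
  intro x y h
  have h1 := oneSidedPValue_sub h.le
  have h2 : 0 < (gaussianReal 0 1).real (Set.Ioc x y) := by
    refine ENNReal.toReal_pos ?_ (measure_ne_top _ _)
    refine ((gaussianReal_pos_of_isOpen 0 isOpen_Ioo (Set.nonempty_Ioo.2 h)).trans_le
      (measure_mono Set.Ioo_subset_Ioc_self)).ne'
  linarith

lemma oneSidedPValue_pos (x : ℝ) : 0 < oneSidedPValue x :=
  lt_of_le_of_lt (by simp [oneSidedPValue_eq_real])
    (strictAnti_oneSidedPValue (lt_add_one x))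

lemma oneSidedPValue_neg (x : ℝ) : oneSidedPValue (-x) = 1 - oneSidedPValue x := by
  have h : gaussianReal 0 1 (Set.Ioi (-x)) = gaussianReal 0 1 (Set.Iio x) := by
    conv_lhs => rw [← neg_zero, ← gaussianReal_map_neg]
    rw [Measure.map_apply measurable_neg measurableSet_Ioi]
    congr 1
    ext y
    simp
  rw [oneSidedPValue_eq_real, measureReal_def, h, measure_congr Iio_ae_eq_Iic, oneSidedPValue,
    stdNormalCDF, cdf_eq_real, measureReal_def]
  ring

lemma oneSidedPValue_lt_one (x : ℝ) : oneSidedPValue x < 1 := by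
  have := oneSidedPValue_pos (-x)
  rw [oneSidedPValue_neg] at this
  linarith

lemma oneSidedPValue_zero : oneSidedPValue 0 = 1 / 2 := by
  have := oneSidedPValue_neg 0
  rw [neg_zero] at this
  linarith

lemma continuous_oneSidedPValue : Continuous oneSidedPValue := by
  have h : oneSidedPValue = fun x => 1 - cdf (gaussianReal 0 1) x := rfl
  rw [h]
  refine continuous_const.sub (continuous_iff_continuousAt.2 fun x => ?_)
  rw [(monotone_cdf _).continuousAt_iff_leftLim_eq_rightLim, StieltjesFunction.rightLim_eq]
  have h0 : (cdf (gaussianReal 0 1)).measure {x} = 0 := by rw [measure_cdf]; simp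
  rw [StieltjesFunction.measure_singleton, ENNReal.ofReal_eq_zero] at h0
  exact le_antisymm ((monotone_cdf _).leftLim_le le_rfl) (by linarith)

lemma tendsto_oneSidedPValue_atTop : Tendsto oneSidedPValue atTop (𝓝 0) := by
  have := (tendsto_cdf_atTop (gaussianReal 0 1)).const_sub 1
  rw [sub_self] at this
  exact this

lemma tendsto_oneSidedPValue_atBot : Tendsto oneSidedPValue atBot (𝓝 1) := by
  have := (tendsto_cdf_atBot (gaussianReal 0 1)).const_sub 1
  rw [sub_zero] at this
  exact this

lemma exists_oneSidedPValue_eq {a : ℝ} (h0 : 0 < a) (h1 : a < 1) : ∃ z, oneSidedPValue z = a := by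
  obtain ⟨x, hx⟩ := (tendsto_oneSidedPValue_atTop.eventually_lt_const h0).exists
  obtain ⟨y, hy⟩ := (tendsto_oneSidedPValue_atBot.eventually_const_lt h1).exists
  exact mem_range_of_exists_le_of_exists_ge continuous_oneSidedPValue ⟨x, hx.le⟩ ⟨y, hy.le⟩

lemma gaussianReal_Icc_oneSidedPValue {b c : ℝ} (hb : 0 < b) (hbc : b ≤ c) (hc : c < 1) :
    gaussianReal 0 1 {t | b ≤ oneSidedPValue t ∧ oneSidedPValue t ≤ c}
      = ENNReal.ofReal (c - b) := by
  obtain ⟨y, hy⟩ := exists_oneSidedPValue_eq hb (hbc.trans_lt hc)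
  obtain ⟨x, hx⟩ := exists_oneSidedPValue_eq (hb.trans_le hbc) hc
  have hxy : x ≤ y := by
    rw [← strictAnti_oneSidedPValue.le_iff_ge, hx, hy]; exact hbc
  have : {t | b ≤ oneSidedPValue t ∧ oneSidedPValue t ≤ c} = Set.Icc x y := by
    ext t
    simp only [Set.mem_ofPred_eq, Set.mem_Icc, ← hx, ← hy, strictAnti_oneSidedPValue.le_iff_ge]
    tauto
  rw [this, ← hx, ← hy, oneSidedPValue_sub hxy, ofReal_measureReal, measure_congr Ioc_ae_eq_Icc]

/-! ### Comparison of shifted normal laws -/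

lemma gaussianPDF_eq_exp_mul (m t : ℝ) :
    gaussianPDF m 1 t = ENNReal.ofReal (Real.exp (m * t - m ^ 2 / 2)) * gaussianPDF 0 1 t := by
  rw [gaussianPDF, gaussianPDF, ← ENNReal.ofReal_mul (Real.exp_nonneg _)]
  congr 1
  simp only [gaussianPDFReal]
  rw [mul_left_comm, ← Real.exp_add]
  congr 2
  simp
  ring

lemma gaussianReal_le_mul {m K : ℝ} {B : Set ℝ} (hB : MeasurableSet B)
    (h : ∀ t ∈ B, Real.exp (m * t - m ^ 2 / 2) ≤ K) :
    gaussianReal m 1 B ≤ ENNReal.ofReal K * gaussianReal 0 1 B := by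
  rw [gaussianReal_apply _ one_ne_zero, gaussianReal_apply _ one_ne_zero,
    ← lintegral_const_mul _ (measurable_gaussianPDF 0 1)]
  refine setLIntegral_mono' hB fun t ht => ?_
  rw [gaussianPDF_eq_exp_mul]
  gcongr
  exact h t ht

lemma mul_le_gaussianReal {m K : ℝ} {B : Set ℝ} (hB : MeasurableSet B)
    (h : ∀ t ∈ B, K ≤ Real.exp (m * t - m ^ 2 / 2)) :
    ENNReal.ofReal K * gaussianReal 0 1 B ≤ gaussianReal m 1 B := by
  rw [gaussianReal_apply _ one_ne_zero, gaussianReal_apply _ one_ne_zero,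
    ← lintegral_const_mul _ (measurable_gaussianPDF 0 1)]
  refine setLIntegral_mono' hB fun t ht => ?_
  rw [gaussianPDF_eq_exp_mul m]
  gcongr
  exact h t ht

lemma gaussianReal_Ioi (m x : ℝ) :
    gaussianReal m 1 (Set.Ioi x) = ENNReal.ofReal (oneSidedPValue (x - m)) := by
  rw [ofReal_oneSidedPValue]
  conv_lhs => rw [← zero_add m, ← gaussianReal_map_add_const]
  rw [Measure.map_apply (by fun_prop) measurableSet_Ioi]
  congr 1
  ext y
  simp [sub_lt_iff_lt_add]

/-- The tail at `x + s` is the mass of `(x, ∞)` under `N(-s, 1)`, whose likelihood ratio to `N(0,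
1)` is at most `exp(-xs)` there. -/
lemma oneSidedPValue_add_le (x : ℝ) {s : ℝ} (hs : 0 ≤ s) :
    oneSidedPValue (x + s) ≤ Real.exp (-(x * s)) * oneSidedPValue x := by
  have h := gaussianReal_le_mul (m := -s) (K := Real.exp (-(x * s))) (B := Set.Ioi x)
    measurableSet_Ioi (fun t ht => Real.exp_le_exp.2 (by
      have := Set.mem_Ioi.1 ht
      nlinarith [sq_nonneg s]))
  rw [gaussianReal_Ioi, ← ofReal_oneSidedPValue, ← ENNReal.ofReal_mul (Real.exp_nonneg _),
    sub_neg_eq_add] at h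
  exact (ENNReal.ofReal_le_ofReal_iff
    (mul_nonneg (Real.exp_nonneg _) (oneSidedPValue_pos x).le)).1 h

lemma eventually_lt_of_oneSidedPValue_le (C M : ℝ) :
    ∀ᶠ a : ℝ in 𝓝[>] 0, ∀ t, oneSidedPValue t ≤ C * a → M < t := by
  have h : Tendsto (fun a : ℝ => C * a) (𝓝[>] 0) (𝓝 0) := by
    have : Tendsto (fun a : ℝ => C * a) (𝓝 0) (𝓝 (C * 0)) := tendsto_id.const_mul C
    rw [mul_zero] at this
    exact this.mono_left nhdsWithin_le_nhds
  filter_upwards [h.eventually_lt_const (oneSidedPValue_pos M)] with a ha t ht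
  exact strictAnti_oneSidedPValue.lt_iff_gt.1 (ht.trans_lt ha)

/-- A unit shift beyond `s` multiplies the tail by at most `exp(-s)`. Small `a` forces `s > C / c`,
so `exp(-s) * C < c` and the tail would fall below `c * a`. -/
lemma eventually_dist_le_one_of_oneSidedPValue {c C : ℝ} (hc : 0 < c) :
    ∀ᶠ a : ℝ in 𝓝[>] 0, ∀ s t, oneSidedPValue s ≤ C * a → c * a ≤ oneSidedPValue t →
      t ≤ s + 1 := by
  filter_upwards [eventually_lt_of_oneSidedPValue_le C (C / c), self_mem_nhdsWithin]
    with a ha ha0 s t hs ht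
  have ha0 : 0 < a := ha0
  by_contra! h
  have h1 := (strictAnti_oneSidedPValue h).trans_le (oneSidedPValue_add_le s zero_le_one)
  have h2 := ha s hs
  have hC : 0 < C := by
    by_contra! hC
    have := oneSidedPValue_pos s
    nlinarith
  have h3 : C / c < Real.exp s := by linarith [Real.add_one_le_exp s]
  rw [div_lt_iff₀ hc] at h3
  have h4 : Real.exp (-(s * 1)) * Real.exp s = 1 := by rw [← Real.exp_add]; simp
  have h5 := Real.exp_pos s
  have h6 := Real.exp_pos (-(s * 1))
  have h7 : c * a < Real.exp (-(s * 1)) * (C * a) :=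
    ht.trans_lt (h1.trans_le (mul_le_mul_of_nonneg_left hs h6.le))
  have h8 : c < Real.exp (-(s * 1)) * C := by nlinarith
  have h9 : Real.exp (-(s * 1)) * C < Real.exp (-(s * 1)) * (Real.exp s * c) := by
    gcongr
  rw [← mul_assoc, h4] at h9
  linarith

lemma measurableSet_oneSidedPValue_mem {S : Set ℝ} (hS : MeasurableSet S) :
    MeasurableSet {t | oneSidedPValue t ∈ S} :=
  continuous_oneSidedPValue.measurable hS

/-- The law of the one-sided p-value of an `N(m, 1)` statistic has, near `0`, comparable density
at comparable arguments. -/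
lemma exists_gaussianReal_band_le (m : ℝ) {C : ℝ} (hC : 1 ≤ C) : ∃ K : ℝ, 0 < K ∧
    ∀ᶠ a : ℝ in 𝓝[>] 0, ∀ b c, a / 2 ≤ b → b ≤ c → c ≤ C * a →
      gaussianReal m 1 {t | b ≤ oneSidedPValue t ∧ oneSidedPValue t ≤ c} ≤
        ENNReal.ofReal (K * ((c - b) / a)) * gaussianReal m 1 {t | oneSidedPValue t < a} := by
  -- On p-values in `[a/4, C * a]` the statistic stays in a unit interval, so the likelihood ratio
  -- oscillates by at most `exp(2|m|)`. The factor 4 comes from the reference band `[a/4, a/2]`, of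
  -- null mass `a/4`.
  refine ⟨4 * Real.exp (2 * |m|), by positivity, ?_⟩
  have hsmall : ∀ᶠ a : ℝ in 𝓝[>] 0, a < 1 / C :=
    nhdsWithin_le_nhds (eventually_lt_nhds (by positivity))
  filter_upwards [eventually_dist_le_one_of_oneSidedPValue (C := C) (c := 1 / 4) (by norm_num),
    self_mem_nhdsWithin, hsmall] with a ha ha0 haC b c hb hbc hc
  have ha0 : 0 < a := ha0
  have hCa : C * a < 1 := by rwa [lt_div_iff₀ (by positivity), mul_comm] at haC
  have haCa : a ≤ C * a := by nlinarith
  obtain ⟨z, hz⟩ := exists_oneSidedPValue_eq (a := C * a) (by positivity) hCa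
  have hrange : ∀ t, a / 4 ≤ oneSidedPValue t → oneSidedPValue t ≤ C * a →
      |m * t - m * z| ≤ |m| := by
    intro t h1 h2
    have h3 := ha z t hz.le (by linarith)
    have h4 : z ≤ t := strictAnti_oneSidedPValue.le_iff_ge.1 (by rw [hz]; exact h2)
    rw [← mul_sub, abs_mul]
    exact mul_le_of_le_one_right (abs_nonneg _) (by rw [abs_le]; constructor <;> linarith)
  have hup : gaussianReal m 1 {t | b ≤ oneSidedPValue t ∧ oneSidedPValue t ≤ c} ≤
      ENNReal.ofReal (Real.exp (m * z + |m| - m ^ 2 / 2)) * ENNReal.ofReal (c - b) := by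
    rw [← gaussianReal_Icc_oneSidedPValue (by linarith) hbc (by linarith)]
    refine gaussianReal_le_mul (measurableSet_oneSidedPValue_mem measurableSet_Icc)
      fun t ht => Real.exp_le_exp.2 ?_
    have := abs_le.1 (hrange t (by linarith [ht.1]) (ht.2.trans hc))
    linarith [this.2]
  have hlow : ENNReal.ofReal (Real.exp (m * z - |m| - m ^ 2 / 2)) * ENNReal.ofReal (a / 2 - a / 4)
      ≤ gaussianReal m 1 {t | oneSidedPValue t < a} := by
    rw [← gaussianReal_Icc_oneSidedPValue (by linarith) (by linarith) (by linarith)]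
    refine (mul_le_gaussianReal (measurableSet_oneSidedPValue_mem measurableSet_Icc)
      fun t ht => Real.exp_le_exp.2 ?_).trans (measure_mono fun t ht => ?_)
    · have := abs_le.1 (hrange t (by linarith [ht.1]) (by linarith [ht.2]))
      linarith [this.1]
    · exact ht.2.trans_lt (by linarith)
  refine hup.trans (le_trans (le_of_eq ?_) (mul_le_mul_right hlow _))
  rw [← ENNReal.ofReal_mul (by positivity), ← ENNReal.ofReal_mul (by positivity),
    ← ENNReal.ofReal_mul (mul_nonneg (by positivity) (div_nonneg (by linarith) ha0.le))]
  congr 1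
  have he : Real.exp (m * z + |m| - m ^ 2 / 2) =
      Real.exp (2 * |m|) * Real.exp (m * z - |m| - m ^ 2 / 2) := by
    rw [← Real.exp_add]; congr 1; ring
  rw [he]
  field_simp
  ring

lemma exists_gaussianReal_oneSidedPValue_le (m : ℝ) {C : ℝ} (hC : 1 ≤ C) : ∃ K : ℝ, 0 < K ∧
    ∀ᶠ a : ℝ in 𝓝[>] 0, gaussianReal m 1 {t | oneSidedPValue t ≤ C * a} ≤
        ENNReal.ofReal K * gaussianReal m 1 {t | oneSidedPValue t < a} := by
  obtain ⟨K, hK, h⟩ := exists_gaussianReal_band_le m hC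
  refine ⟨1 + K * (C - 1), by nlinarith, ?_⟩
  filter_upwards [h, self_mem_nhdsWithin] with a ha ha0
  have ha0 : 0 < a := ha0
  have h1 := ha a (C * a) (by linarith) (by nlinarith) le_rfl
  rw [show (C * a - a) / a = C - 1 by field_simp] at h1
  rw [ENNReal.ofReal_add zero_le_one (by nlinarith), add_mul, ENNReal.ofReal_one, one_mul]
  refine le_trans (measure_mono fun t ht => ?_)
    ((measure_union_le _ _).trans (add_le_add_right h1 _))
  rcases lt_or_ge (oneSidedPValue t) a with h | h
  · exact Or.inl h
  · exact Or.inr ⟨h, ht⟩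

lemma exists_gaussianReal_shell_le (m : ℝ) {η : ℝ} (hη : 0 < η) : ∃ ε₀ : ℝ, 0 < ε₀ ∧
    ∀ ε, 0 < ε → ε ≤ ε₀ → ∀ᶠ a : ℝ in 𝓝[>] 0,
      gaussianReal m 1 {t | (1 - ε) * a ≤ oneSidedPValue t ∧ oneSidedPValue t ≤ (1 + ε) * a} ≤
        ENNReal.ofReal η * gaussianReal m 1 {t | oneSidedPValue t < a} := by
  obtain ⟨K, hK, h⟩ := exists_gaussianReal_band_le m one_le_two
  -- The shell has relative width `2ε`; `ε ≤ 1/2` keeps it inside `[a/2, 2a]`.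
  refine ⟨min (1 / 2) (η / (2 * K)), by positivity, fun ε hε hε₀ => ?_⟩
  have h1 := hε₀.trans (min_le_left _ _)
  have h2 := hε₀.trans (min_le_right _ _)
  rw [le_div_iff₀ (by positivity)] at h2
  filter_upwards [h, self_mem_nhdsWithin] with a ha ha0
  have ha0 : 0 < a := ha0
  refine (ha _ _ (by nlinarith) (by nlinarith) (by nlinarith)).trans ?_
  rw [show ((1 + ε) * a - (1 - ε) * a) / a = 2 * ε by field_simp; ring]
  gcongr
  linarith

/-! ### Gaussian pairs -/

/-- `(X, Y)` is bivariate normal with means `m₁`, `m₂`, unit variances and a correlation in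
`[-ρ₀, ρ₀]`. -/
structure IsNormalPair {Ω : Type*} [MeasurableSpace Ω] (P : Measure Ω) (X Y : Ω → ℝ)
    (m₁ m₂ ρ₀ : ℝ) : Prop where
  hasGaussianLaw : HasGaussianLaw (fun ω => (X ω, Y ω)) P
  map_left : P.map X = gaussianReal m₁ 1
  map_right : P.map Y = gaussianReal m₂ 1
  abs_covariance_le : |cov[X, Y; P]| ≤ ρ₀

namespace IsNormalPair

variable {Ω : Type*} [MeasurableSpace Ω] {P : Measure Ω} {X Y : Ω → ℝ} {m₁ m₂ ρ₀ : ℝ}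

lemma symm (h : IsNormalPair P X Y m₁ m₂ ρ₀) : IsNormalPair P Y X m₂ m₁ ρ₀ where
  hasGaussianLaw := h.hasGaussianLaw.map_fun
    ((ContinuousLinearMap.snd ℝ ℝ ℝ).prod (ContinuousLinearMap.fst ℝ ℝ ℝ))
  map_left := h.map_right
  map_right := h.map_left
  abs_covariance_le := by rw [covariance_comm]; exact h.abs_covariance_le

/-- The covariance range is symmetric, so sign changes preserve the class; this reduces every tail
quadrant to the upper one. -/
lemma neg_right (h : IsNormalPair P X Y m₁ m₂ ρ₀) :
    IsNormalPair P X (fun ω => -Y ω) m₁ (-m₂) ρ₀ where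
  hasGaussianLaw := h.hasGaussianLaw.map_fun
    ((ContinuousLinearMap.fst ℝ ℝ ℝ).prod (-ContinuousLinearMap.snd ℝ ℝ ℝ))
  map_left := h.map_left
  map_right := by
    rw [← gaussianReal_map_neg, ← h.map_right,
      AEMeasurable.map_map_of_aemeasurable (by fun_prop) h.hasGaussianLaw.snd.aemeasurable]
    rfl
  abs_covariance_le := by rw [covariance_fun_neg_right, abs_neg]; exact h.abs_covariance_le

lemma neg_left (h : IsNormalPair P X Y m₁ m₂ ρ₀) :
    IsNormalPair P (fun ω => -X ω) Y (-m₁) m₂ ρ₀ := h.symm.neg_right.symm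

lemma variance_left (h : IsNormalPair P X Y m₁ m₂ ρ₀) : Var[X; P] = 1 := by
  rw [← variance_id_map h.hasGaussianLaw.fst.aemeasurable, h.map_left, variance_id_gaussianReal]
  rfl

lemma integral_left (h : IsNormalPair P X Y m₁ m₂ ρ₀) : P[X] = m₁ := by
  have := integral_map (f := fun x : ℝ => x) h.hasGaussianLaw.fst.aemeasurable
    (by fun_prop)
  rw [h.map_left, integral_id_gaussianReal] at this
  exact this.symm

/-- The residual `W = Y - ρ X` of the regression of `Y` on `X`. -/
lemma exists_regression (h : IsNormalPair P X Y m₁ m₂ ρ₀) : ∃ ρ : ℝ, |ρ| ≤ ρ₀ ∧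
    IndepFun X (fun ω => Y ω - ρ * X ω) P ∧
    P.map (fun ω => Y ω - ρ * X ω) = gaussianReal (m₂ - ρ * m₁) (1 - ρ ^ 2).toNNReal := by
  have := h.hasGaussianLaw.isProbabilityMeasure
  set ρ := cov[X, Y; P] with hρ
  have hX2 : MemLp X 2 P := h.hasGaussianLaw.fst.memLp_two
  have hY2 : MemLp Y 2 P := h.hasGaussianLaw.snd.memLp_two
  have hρX2 : MemLp (fun ω => ρ * X ω) 2 P := hX2.const_mul ρ
  have hXW : HasGaussianLaw (fun ω => (X ω, Y ω - ρ * X ω)) P := h.hasGaussianLaw.map_fun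
    ((ContinuousLinearMap.fst ℝ ℝ ℝ).prod
      (ContinuousLinearMap.snd ℝ ℝ ℝ - ρ • ContinuousLinearMap.fst ℝ ℝ ℝ))
  refine ⟨ρ, h.abs_covariance_le, hXW.indepFun_of_covariance_eq_zero ?_, ?_⟩
  · rw [covariance_fun_sub_right hX2 hY2 hρX2, covariance_const_mul_right,
      covariance_self hX2.aemeasurable, h.variance_left, ← hρ]
    ring
  · rw [hXW.snd.map_eq_gaussianReal]
    congr 1
    · rw [integral_sub (hY2.integrable one_le_two) (hρX2.integrable one_le_two),
        integral_const_mul, h.integral_left, h.symm.integral_left]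
    · congr 1
      rw [variance_fun_sub hY2 hρX2, variance_const_mul, covariance_const_mul_right, h.variance_left,
        h.symm.variance_left, covariance_comm, ← hρ]
      ring

lemma measure_preimage_left (h : IsNormalPair P X Y m₁ m₂ ρ₀) {B : Set ℝ}
    (hB : MeasurableSet B) : P (X ⁻¹' B) = gaussianReal m₁ 1 B := by
  rw [← h.map_left, Measure.map_apply_of_aemeasurable h.hasGaussianLaw.fst.aemeasurable hB]

end IsNormalPair

/-- Chebyshev's inequality suffices, since only convergence to zero is needed, and it covers zero
variance. -/
lemma gaussianReal_Ici_le_inv_sq {m v x : ℝ} (hx : m < x) (hv : v ≤ 1) :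
    gaussianReal m v.toNNReal (Set.Ici x) ≤ ENNReal.ofReal (1 / (x - m) ^ 2) := by
  have h := meas_ge_le_variance_div_sq (memLp_id_gaussianReal (μ := m) (v := v.toNNReal) 2)
    (sub_pos.2 hx)
  rw [variance_id_gaussianReal] at h
  simp only [id, integral_id_gaussianReal] at h
  refine (measure_mono fun t ht => ?_).trans (h.trans ?_)
  · have : x ≤ t := ht
    exact (sub_le_sub_right this m).trans (le_abs_self _)
  · gcongr
    simpa using hv

lemma tendsto_shiftBound (m₁ m₂ ρ₀ : ℝ) (hρ₀ : ρ₀ < 1) :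
    Tendsto (fun z : ℝ => Real.exp (-(z - m₁)) +
      1 / ((1 - ρ₀) * z - (ρ₀ + |m₂| + ρ₀ * |m₁|)) ^ 2) atTop (𝓝 0) := by
  rw [← add_zero (0 : ℝ)]
  refine Tendsto.add ?_ ?_
  · refine Real.tendsto_exp_atBot.comp (tendsto_neg_atTop_atBot.comp ?_)
    exact tendsto_atTop_add_const_right _ _ tendsto_id
  · simp only [one_div]
    refine (Tendsto.comp (tendsto_pow_atTop two_ne_zero) ?_).inv_tendsto_atTop
    exact tendsto_atTop_add_const_right _ _ (tendsto_id.const_mul_atTop (sub_pos.2 hρ₀))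

/-- Joint exceedance of a high level `z` by a Gaussian pair. -/
lemma IsNormalPair.measure_joint_Ici_le {Ω : Type*} [MeasurableSpace Ω] {P : Measure Ω}
    {X Y : Ω → ℝ} {m₁ m₂ ρ₀ z : ℝ} (h : IsNormalPair P X Y m₁ m₂ ρ₀) (hz : 0 ≤ z)
    (hz' : ρ₀ + |m₂| + ρ₀ * |m₁| < (1 - ρ₀) * z) :
    P {ω | z ≤ X ω ∧ z ≤ Y ω} ≤ ENNReal.ofReal (Real.exp (-(z - m₁)) +
      1 / ((1 - ρ₀) * z - (ρ₀ + |m₂| + ρ₀ * |m₁|)) ^ 2) * gaussianReal m₁ 1 (Set.Ici z) := by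
  have hprob := h.hasGaussianLaw.isProbabilityMeasure
  obtain ⟨ρ, hρ, hind, hW⟩ := h.exists_regression
  have hρ1 := abs_le.1 hρ
  set w := (1 - ρ₀) * z - ρ₀ with hw
  -- Unless `X` overshoots `z` by more than 1, which is relatively negligible, the residual is at
  -- least `z - ρ₀ (z + 1) = w`. This bound no longer involves `X`, so independence applies.
  have hsub : {ω | z ≤ X ω ∧ z ≤ Y ω} ⊆ X ⁻¹' (Set.Ioi (z + 1)) ∪
      (X ⁻¹' (Set.Ici z) ∩ (fun ω => Y ω - ρ * X ω) ⁻¹' (Set.Ici w)) := by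
    rintro ω ⟨h1, h2⟩
    rcases lt_or_ge (z + 1) (X ω) with h3 | h3
    · exact Or.inl h3
    · refine Or.inr ⟨h1, ?_⟩
      change w ≤ Y ω - ρ * X ω
      have h4 : ρ * X ω ≤ ρ₀ * X ω := by
        gcongr
        · linarith
        · exact hρ1.2
      have h5 : ρ₀ * X ω ≤ ρ₀ * (z + 1) := by
        have : 0 ≤ ρ₀ := (abs_nonneg _).trans hρ
        gcongr
      rw [hw]
      linarith
  have hmean : m₂ - ρ * m₁ ≤ |m₂| + ρ₀ * |m₁| := by
    have h1 := le_abs_self m₂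
    have h2 := neg_abs_le (ρ * m₁)
    rw [abs_mul] at h2
    have h3 := mul_le_mul_of_nonneg_right hρ (abs_nonneg m₁)
    linarith
  have hWle : P ((fun ω => Y ω - ρ * X ω) ⁻¹' (Set.Ici w)) ≤
      ENNReal.ofReal (1 / ((1 - ρ₀) * z - (ρ₀ + |m₂| + ρ₀ * |m₁|)) ^ 2) := by
    rw [← Measure.map_apply_of_aemeasurable ?_ measurableSet_Ici, hW]
    · refine (gaussianReal_Ici_le_inv_sq (by linarith) (by nlinarith [sq_nonneg ρ])).trans ?_
      refine ENNReal.ofReal_le_ofReal (one_div_le_one_div_of_le ?_ ?_)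
      · exact pow_pos (by linarith) 2
      · exact pow_le_pow_left₀ (by linarith) (by linarith) 2
    · exact h.hasGaussianLaw.snd.aemeasurable.sub
        (h.hasGaussianLaw.fst.aemeasurable.const_mul ρ)
  have hshift : gaussianReal m₁ 1 (Set.Ioi (z + 1)) ≤
      ENNReal.ofReal (Real.exp (-(z - m₁))) * gaussianReal m₁ 1 (Set.Ici z) := by
    refine le_trans ?_ (mul_le_mul_right (measure_mono Set.Ioi_subset_Ici_self) _)
    rw [gaussianReal_Ioi, gaussianReal_Ioi, ← ENNReal.ofReal_mul (Real.exp_nonneg _)]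
    refine ENNReal.ofReal_le_ofReal ?_
    have := oneSidedPValue_add_le (z - m₁) zero_le_one
    rwa [mul_one, show z - m₁ + 1 = z + 1 - m₁ by ring] at this
  refine (measure_mono hsub).trans ((measure_union_le _ _).trans ?_)
  rw [hind.measure_inter_preimage_eq_mul _ _ measurableSet_Ici measurableSet_Ici,
    h.measure_preimage_left measurableSet_Ioi, h.measure_preimage_left measurableSet_Ici,
    ENNReal.ofReal_add (Real.exp_nonneg _) (by positivity), add_mul]
  refine add_le_add hshift ?_
  rw [mul_comm]
  gcongr

/-- Tail independence of Gaussian pairs, uniformly over the correlations in `[-ρ₀, ρ₀]`. -/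
lemma eventually_measure_joint_le (Ω : Type*) [MeasurableSpace Ω] (m₁ m₂ : ℝ) {ρ₀ : ℝ}
    (hρ₀ : ρ₀ < 1) (C : ℝ) {η : ℝ} (hη : 0 < η) :
    ∀ᶠ a : ℝ in 𝓝[>] 0, ∀ (P : Measure Ω) (X Y : Ω → ℝ), IsNormalPair P X Y m₁ m₂ ρ₀ →
      P {ω | oneSidedPValue (X ω) ≤ C * a ∧ oneSidedPValue (Y ω) ≤ C * a} ≤
        ENNReal.ofReal η * P {ω | oneSidedPValue (X ω) < a} := by
  wlog hC : 1 ≤ C generalizing C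
  · filter_upwards [this 1 le_rfl, self_mem_nhdsWithin] with a ha ha0 P X Y h
    have ha0 : 0 < a := ha0
    refine (measure_mono fun ω hω => ?_).trans (ha P X Y h)
    have h1 : C * a ≤ 1 * a := by nlinarith
    exact ⟨hω.1.trans h1, hω.2.trans h1⟩
  obtain ⟨K, hK, hKle⟩ := exists_gaussianReal_oneSidedPValue_le m₁ hC
  -- The pair bound is relative to the level `C * a`; returning to the level `a` costs the factor
  -- `K`.
  have hzbig : ∀ᶠ z : ℝ in atTop, (0 ≤ z ∧ ρ₀ + |m₂| + ρ₀ * |m₁| < (1 - ρ₀) * z) ∧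
      Real.exp (-(z - m₁)) + 1 / ((1 - ρ₀) * z - (ρ₀ + |m₂| + ρ₀ * |m₁|)) ^ 2 ≤ η / K :=
    ((eventually_ge_atTop 0).and ((tendsto_id.const_mul_atTop
      (sub_pos.2 hρ₀)).eventually_gt_atTop _)).and
      ((tendsto_shiftBound m₁ m₂ ρ₀ hρ₀).eventually_le_const (by positivity))
  obtain ⟨M, hM⟩ := eventually_atTop.1 hzbig
  have hsmall : ∀ᶠ a : ℝ in 𝓝[>] 0, a < 1 / C :=
    nhdsWithin_le_nhds (eventually_lt_nhds (by positivity))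
  filter_upwards [hKle, eventually_lt_of_oneSidedPValue_le C M, self_mem_nhdsWithin, hsmall]
    with a ha1 ha2 ha0 haC P X Y h
  have ha0 : 0 < a := ha0
  obtain ⟨z, hz⟩ := exists_oneSidedPValue_eq (a := C * a) (by positivity)
    (by rwa [lt_div_iff₀ (by positivity), mul_comm] at haC)
  obtain ⟨⟨hz0, hz1⟩, hz2⟩ := hM z (ha2 z hz.le).le
  have hIci : {t | oneSidedPValue t ≤ C * a} = Set.Ici z := by
    ext t
    rw [← hz]
    exact strictAnti_oneSidedPValue.le_iff_ge
  have hset : {ω | oneSidedPValue (X ω) ≤ C * a ∧ oneSidedPValue (Y ω) ≤ C * a} =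
      {ω | z ≤ X ω ∧ z ≤ Y ω} := by
    ext ω
    rw [← hz]
    exact and_congr strictAnti_oneSidedPValue.le_iff_ge strictAnti_oneSidedPValue.le_iff_ge
  have hX : P {ω | oneSidedPValue (X ω) < a} = gaussianReal m₁ 1 {t | oneSidedPValue t < a} :=
    h.measure_preimage_left (measurableSet_oneSidedPValue_mem measurableSet_Iio)
  rw [hset, hX]
  rw [hIci] at ha1
  refine (h.measure_joint_Ici_le hz0 hz1).trans ((mul_le_mul' (ENNReal.ofReal_le_ofReal hz2)
    ha1).trans (le_of_eq ?_))
  rw [← mul_assoc, ← ENNReal.ofReal_mul (by positivity), div_mul_cancel₀ _ hK.ne']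

/-! ### Small balls -/

lemma gaussianReal_le_mul_volume (m : ℝ) {v v₀ : ℝ} (hv₀ : 0 < v₀) (hv : v₀ ≤ v) (B : Set ℝ) :
    gaussianReal m v.toNNReal B ≤ ENNReal.ofReal (1 / √v₀) * volume B := by
  have hvpos : v.toNNReal ≠ 0 := by
    simpa using hv₀.trans_le hv
  rw [gaussianReal_apply _ hvpos, ← setLIntegral_const]
  refine lintegral_mono fun t => ENNReal.ofReal_le_ofReal ?_
  rw [gaussianPDFReal, Real.coe_toNNReal _ (hv₀.le.trans hv), ← one_div]
  refine (mul_le_of_le_one_right (by positivity) (Real.exp_le_one_iff.2 ?_)).trans ?_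
  · rw [neg_div, neg_nonpos]
    have := hv₀.trans_le hv
    positivity
  · refine one_div_le_one_div_of_le (by positivity) (Real.sqrt_le_sqrt ?_)
    nlinarith [Real.pi_gt_three]

/-- Given `X`, the conditional density of `Y` is bounded, uniformly over the correlations in
`[-ρ₀, ρ₀]`. -/
lemma IsNormalPair.measure_abs_le {Ω : Type*} [MeasurableSpace Ω] {P : Measure Ω}
    {X Y : Ω → ℝ} {m₁ m₂ ρ₀ : ℝ} (h : IsNormalPair P X Y m₁ m₂ ρ₀) (hρ₀ : ρ₀ < 1)
    {B : Set ℝ} (hB : MeasurableSet B) (ε : ℝ) :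
    P {ω | X ω ∈ B ∧ |Y ω| ≤ ε} ≤
      ENNReal.ofReal (1 / √(1 - ρ₀ ^ 2)) * ENNReal.ofReal (2 * ε) * P {ω | X ω ∈ B} := by
  have hprob := h.hasGaussianLaw.isProbabilityMeasure
  obtain ⟨ρ, hρ, hind, hW⟩ := h.exists_regression
  have hX := h.hasGaussianLaw.fst.aemeasurable
  have hWm : AEMeasurable (fun ω => Y ω - ρ * X ω) P :=
    h.hasGaussianLaw.snd.aemeasurable.sub (hX.const_mul ρ)
  have hρ00 : 0 ≤ ρ₀ := (abs_nonneg _).trans hρ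
  have hv : 1 - ρ₀ ^ 2 ≤ 1 - ρ ^ 2 := by
    have := sq_le_sq.2 (by rwa [abs_of_nonneg hρ00] : |ρ| ≤ |ρ₀|)
    linarith
  have hv₀ : 0 < 1 - ρ₀ ^ 2 := by nlinarith
  have hE : MeasurableSet {q : ℝ × ℝ | q.1 ∈ B ∧ |q.2 + ρ * q.1| ≤ ε} :=
    (measurable_fst hB).inter
      (measurableSet_le (f := fun q : ℝ × ℝ => |q.2 + ρ * q.1|) (by fun_prop) measurable_const)
  have hmap := (indepFun_iff_map_prod_eq_prod_map_map hX hWm).1 hind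
  have heq : P {ω | X ω ∈ B ∧ |Y ω| ≤ ε} =
      ((P.map X).prod (P.map fun ω => Y ω - ρ * X ω))
        {q : ℝ × ℝ | q.1 ∈ B ∧ |q.2 + ρ * q.1| ≤ ε} := by
    rw [← hmap, Measure.map_apply_of_aemeasurable (hX.prodMk hWm) hE]
    congr 1
    ext ω
    simp
  have hXB : P {ω | X ω ∈ B} = P.map X B := (Measure.map_apply_of_aemeasurable hX hB).symm
  -- On the slice `X = t`, the constraint `|Y| ≤ ε` confines the residual to an interval of length
  -- `2ε`, and the residual variance is at least `1 - ρ₀²`.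
  rw [heq, Measure.prod_apply hE, hXB, ← setLIntegral_const, ← lintegral_indicator hB]
  refine lintegral_mono fun t => ?_
  by_cases ht : t ∈ B
  · rw [Set.indicator_of_mem ht, hW]
    refine (gaussianReal_le_mul_volume _ hv₀ hv _).trans (mul_le_mul_right ?_ _)
    rw [show 2 * ε = (ε - ρ * t) - (-ε - ρ * t) by ring, ← Real.volume_Icc]
    refine measure_mono fun s hs => ?_
    have := abs_le.1 hs.2
    exact ⟨by linarith [this.1], by linarith [this.2]⟩
  · rw [Set.indicator_of_notMem ht]
    simp [ht]

/-! ### Quantiles of a distribution function -/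

section Quantile

variable {ν : Measure ℝ}

lemma quantile_le_of_le_cdf {t y : ℝ} (ht : 0 < t) (h : t ≤ cdf ν y) : quantile (cdf ν) t ≤ y := by
  refine csInf_le ?_ h
  obtain ⟨b, hb⟩ := ((tendsto_cdf_atBot ν).eventually_lt_const ht).exists
  exact ⟨b, fun x hx => ((monotone_cdf ν).reflect_lt (hb.trans_le hx)).le⟩

lemma cdf_lt_of_lt_quantile {t y : ℝ} (ht : 0 < t) (h : y < quantile (cdf ν) t) : cdf ν y < t := by
  by_contra! h'
  exact (quantile_le_of_le_cdf ht h').not_gt h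

lemma le_cdf_of_quantile_lt {t y : ℝ} (ht : t < 1) (h : quantile (cdf ν) t < y) : t ≤ cdf ν y := by
  have hne : {x : ℝ | t ≤ cdf ν x}.Nonempty :=
    ((tendsto_cdf_atTop ν).eventually_const_le ht).exists
  obtain ⟨x, hx, hxy⟩ := exists_lt_of_csInf_lt hne h
  exact le_trans hx (monotone_cdf ν hxy.le)

/-- At level 0 the infimum over all of `ℝ` takes the default value `0`, not `-∞`. A two-sided
p-value equal to 1 reaches this case. -/
lemma quantile_zero : quantile (cdf ν) 0 = 0 := by
  have : {x : ℝ | 0 ≤ cdf ν x} = Set.univ := Set.eq_univ_of_forall fun x => cdf_nonneg ν x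
  rw [quantile, this, Real.sInf_univ]

lemma lt_one_sub_cdf_of_lt_quantile {p y : ℝ} (hp : p ≤ 1) (hy : 0 ≤ y)
    (h : y < quantile (cdf ν) (1 - p)) : p < 1 - cdf ν y := by
  rcases hp.lt_or_eq with hp | rfl
  · linarith [cdf_lt_of_lt_quantile (by linarith) h]
  · rw [sub_self, quantile_zero] at h
    linarith

lemma one_sub_cdf_le_of_quantile_lt {p y : ℝ} (hp : 0 < p)
    (h : quantile (cdf ν) (1 - p) < y) : 1 - cdf ν y ≤ p := by
  linarith [le_cdf_of_quantile_lt (by linarith) h]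

/-! ### Regularly varying tails -/

variable {γ : ℝ}

/-- If the tail vanished eventually, the defining ratio at `y = 1` would be `0 / 0 = 0` and could
not tend to 1. -/
lemma RegularlyVaryingTail.cdf_lt_one (hF : RegularlyVaryingTail (cdf ν) γ) (x : ℝ) :
    cdf ν x < 1 := by
  have h := hF.2 1 one_pos
  rw [Real.one_rpow] at h
  obtain ⟨y, hy, hxy⟩ := ((h.eventually_ne one_ne_zero).and (eventually_ge_atTop x)).exists
  refine lt_of_le_of_ne (cdf_le_one ν x) fun hx => hy ?_
  have : cdf ν y = 1 := le_antisymm (cdf_le_one ν y) (hx ▸ monotone_cdf ν hxy)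
  rw [this, sub_self, div_zero]

lemma RegularlyVaryingTail.tendsto_div (hF : RegularlyVaryingTail (cdf ν) γ) {r s : ℝ}
    (hr : 0 < r) (hs : 0 < s) :
    Tendsto (fun x => (1 - cdf ν (s * x)) / (1 - cdf ν (r * x))) atTop (𝓝 ((s / r) ^ (-γ))) := by
  have h := (hF.2 s hs).div (hF.2 r hr) (Real.rpow_pos_of_pos hr _).ne'
  rw [← Real.div_rpow hs.le hr.le] at h
  refine h.congr fun x => ?_
  have h1 := hF.cdf_lt_one x
  simp only [Pi.div_apply]
  rw [div_div_div_cancel_right₀ (by linarith), mul_comm s, mul_comm r]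

lemma RegularlyVaryingTail.tendsto_quantile (hF : RegularlyVaryingTail (cdf ν) γ) :
    Tendsto (fun a : ℝ => quantile (cdf ν) (1 - a)) (𝓝[>] 0) atTop := by
  rw [tendsto_atTop]
  intro M
  have h0 : ∀ᶠ a : ℝ in 𝓝[>] 0, a < 1 - cdf ν M :=
    nhdsWithin_le_nhds (eventually_lt_nhds (by linarith [hF.cdf_lt_one M]))
  filter_upwards [h0, self_mem_nhdsWithin] with a ha ha0
  have ha0 : 0 < a := ha0
  by_contra! h
  linarith [one_sub_cdf_le_of_quantile_lt ha0 h]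

/-- Since `F` may jump, the tail at `x = Q_F(1 - a)` need not equal `a`; what is used is that it is
at most `a` at `(1 + δ)x` and above `a` at `(1 - δ)x`. The resulting loss is absorbed into `1 ± ε`.
-/
lemma exists_rpow_near_one (γ : ℝ) {ε : ℝ} (hε : 0 < ε) : ∃ δ : ℝ, 0 < δ ∧ δ < 1 ∧
    1 - ε < ((1 + δ) / (1 - δ)) ^ (-γ) ∧ ((1 - δ) / (1 + δ)) ^ (-γ) < 1 + ε := by
  have h1 : ContinuousAt (fun δ : ℝ => ((1 + δ) / (1 - δ)) ^ (-γ)) 0 := by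
    refine ContinuousAt.rpow_const (ContinuousAt.div ?_ ?_ (by norm_num)) (Or.inl (by norm_num))
    all_goals fun_prop
  have h2 : ContinuousAt (fun δ : ℝ => ((1 - δ) / (1 + δ)) ^ (-γ)) 0 := by
    refine ContinuousAt.rpow_const (ContinuousAt.div ?_ ?_ (by norm_num)) (Or.inl (by norm_num))
    all_goals fun_prop
  have h1' := h1.eventually_const_lt (u := 1 - ε) (by simpa using hε)
  have h2' := h2.eventually_lt_const (u := 1 + ε) (by simpa using hε)
  have hlt : ∀ᶠ δ : ℝ in 𝓝[>] 0, δ < 1 := nhdsWithin_le_nhds (eventually_lt_nhds one_pos)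
  obtain ⟨δ, h3, h4, h5, h6⟩ := ((eventually_mem_nhdsWithin (a := (0 : ℝ)) (s := Set.Ioi 0)).and
    (hlt.and ((h1'.filter_mono nhdsWithin_le_nhds).and (h2'.filter_mono nhdsWithin_le_nhds)))).exists
  exact ⟨δ, h3, h4, h5, h6⟩

/-- Otherwise the tail at `(1 + δ)x / w` would be at most `p`, whereas regular variation makes it
exceed `(1 - ε) w^γ` times the tail at `(1 - δ)x`, hence `(1 - ε) w^γ a`. -/
lemma RegularlyVaryingTail.eventually_le_mul_quantile (hF : RegularlyVaryingTail (cdf ν) γ)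
    {ε δ w : ℝ} (hδ : 0 < δ) (hδ1 : δ < 1) (hδγ : 1 - ε < ((1 + δ) / (1 - δ)) ^ (-γ))
    (hw : 0 < w) :
    ∀ᶠ a : ℝ in 𝓝[>] 0, ∀ p, 0 < p → p < (1 - ε) * (w ^ γ * a) →
      (1 + δ) * quantile (cdf ν) (1 - a) ≤ w * quantile (cdf ν) (1 - p) := by
  have h := hF.tendsto_div (sub_pos.2 hδ1) (show 0 < (1 + δ) / w by positivity)
  have hlim : (1 - ε) * w ^ γ < ((1 + δ) / w / (1 - δ)) ^ (-γ) := by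
    rw [div_right_comm, Real.div_rpow (div_nonneg (by linarith) (by linarith)) hw.le,
      Real.rpow_neg hw.le γ, div_inv_eq_mul]
    gcongr
  have hsmall : ∀ᶠ a : ℝ in 𝓝[>] 0, a < 1 := nhdsWithin_le_nhds (eventually_lt_nhds one_pos)
  filter_upwards [hF.tendsto_quantile.eventually (h.eventually_const_lt hlim),
    hF.tendsto_quantile.eventually_gt_atTop 0, self_mem_nhdsWithin, hsmall]
    with a ha hx ha0 ha1 p hp hpa
  have ha0 : 0 < a := ha0
  set x := quantile (cdf ν) (1 - a) with hxdef
  by_contra! hlt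
  have h1 : 1 - cdf ν ((1 + δ) / w * x) ≤ p := by
    refine one_sub_cdf_le_of_quantile_lt hp ?_
    rw [div_mul_eq_mul_div, lt_div_iff₀ hw]
    linarith
  have h2 : a < 1 - cdf ν ((1 - δ) * x) :=
    lt_one_sub_cdf_of_lt_quantile ha1.le (mul_nonneg (by linarith) hx.le) (by
      rw [← hxdef]; nlinarith)
  rw [lt_div_iff₀ (by linarith)] at ha
  have h3 : (0 : ℝ) < (1 - ε) * w ^ γ := by
    by_contra! h4
    nlinarith
  nlinarith

lemma RegularlyVaryingTail.eventually_mul_quantile_le (hF : RegularlyVaryingTail (cdf ν) γ)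
    {ε δ w : ℝ} (hε : 0 < ε) (hδ : 0 < δ) (hδ1 : δ < 1)
    (hδγ : ((1 - δ) / (1 + δ)) ^ (-γ) < 1 + ε) (hw : 0 < w) :
    ∀ᶠ a : ℝ in 𝓝[>] 0, ∀ p, p ≤ 1 → (1 + ε) * (w ^ γ * a) < p →
      w * quantile (cdf ν) (1 - p) ≤ (1 - δ) * quantile (cdf ν) (1 - a) := by
  have h := hF.tendsto_div (show 0 < 1 + δ by linarith)
    (show 0 < (1 - δ) / w from div_pos (sub_pos.2 hδ1) hw)
  have hlim : ((1 - δ) / w / (1 + δ)) ^ (-γ) < (1 + ε) * w ^ γ := by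
    rw [div_right_comm, Real.div_rpow (div_nonneg (by linarith) (by linarith)) hw.le,
      Real.rpow_neg hw.le γ, div_inv_eq_mul]
    gcongr
  filter_upwards [hF.tendsto_quantile.eventually (h.eventually_lt_const hlim),
    hF.tendsto_quantile.eventually_gt_atTop 0, self_mem_nhdsWithin] with a ha hx ha0 p hp hpa
  have ha0 : 0 < a := ha0
  set x := quantile (cdf ν) (1 - a) with hxdef
  by_contra! hlt
  have h1 : p < 1 - cdf ν ((1 - δ) / w * x) := by
    refine lt_one_sub_cdf_of_lt_quantile hp (mul_nonneg (div_nonneg (by linarith) hw.le) hx.le) ?_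
    rw [div_mul_eq_mul_div, div_lt_iff₀ hw]
    linarith
  have h2 : 1 - cdf ν ((1 + δ) * x) ≤ a :=
    one_sub_cdf_le_of_quantile_lt ha0 (by rw [← hxdef]; nlinarith)
  rw [div_lt_iff₀ (by linarith [hF.cdf_lt_one ((1 + δ) * x)])] at ha
  have h3 : (1 + ε) * w ^ γ * (1 - cdf ν ((1 + δ) * x)) ≤ (1 + ε) * w ^ γ * a := by
    gcongr
  linarith

lemma RegularlyVaryingTail.exists_tail_quantile_le (hF : RegularlyVaryingTail (cdf ν) γ) {c : ℝ}
    (hc : 0 < c) : ∃ C : ℝ, 0 < C ∧ ∀ᶠ a : ℝ in 𝓝[>] 0,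
      1 - cdf ν (c * quantile (cdf ν) (1 - a)) ≤ C * a := by
  have h := hF.tendsto_div two_pos hc
  have hpos : 0 < (c / 2) ^ (-γ) := by positivity
  refine ⟨(c / 2) ^ (-γ) + 1, by positivity, ?_⟩
  filter_upwards [hF.tendsto_quantile.eventually (h.eventually_lt_const (lt_add_one _)),
    hF.tendsto_quantile.eventually_gt_atTop 0, self_mem_nhdsWithin] with a ha hx ha0
  have ha0 : 0 < a := ha0
  have h2 : 1 - cdf ν (2 * quantile (cdf ν) (1 - a)) ≤ a :=
    one_sub_cdf_le_of_quantile_lt ha0 (by linarith)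
  rw [div_lt_iff₀ (by linarith [hF.cdf_lt_one (2 * quantile (cdf ν) (1 - a))])] at ha
  exact ha.le.trans (by gcongr)

end Quantile

lemma tendsto_const_mul_nhdsGT_zero {c : ℝ} (hc : 0 < c) :
    Tendsto (fun a : ℝ => c * a) (𝓝[>] 0) (𝓝[>] 0) := by
  refine tendsto_nhdsWithin_iff.2 ⟨?_, ?_⟩
  · have : Tendsto (fun a : ℝ => c * a) (𝓝 0) (𝓝 (c * 0)) := tendsto_id.const_mul c
    rw [mul_zero] at this
    exact this.mono_left nhdsWithin_le_nhds
  · filter_upwards [self_mem_nhdsWithin] with a ha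
    exact mul_pos hc ha

lemma tendsto_div_const_nhdsGT_zero {c : ℝ} (hc : 0 < c) :
    Tendsto (fun a : ℝ => a / c) (𝓝[>] 0) (𝓝[>] 0) :=
  (tendsto_const_mul_nhdsGT_zero (inv_pos.2 hc)).congr fun a => by rw [div_eq_inv_mul]

/-! ### The two tests -/

variable {n : ℕ}

lemma weightPow_nonneg (γ : ℝ) {w : ℝ} (hw : 0 ≤ w) : 0 ≤ weightPow γ w := by
  rw [weightPow]
  split_ifs
  · exact le_rfl
  · exact Real.rpow_nonneg hw γ

lemma weightPow_of_pos (γ : ℝ) {w : ℝ} (hw : 0 < w) : weightPow γ w = w ^ γ := if_neg hw.ne'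

lemma kappa_pos (γ : ℝ) {ω : Fin n → ℝ} (hω : ∀ i, 0 ≤ ω i) (hω' : ∃ i, 0 < ω i) :
    0 < kappa γ ω := by
  obtain ⟨i, hi⟩ := hω'
  refine Finset.sum_pos' (fun j _ => weightPow_nonneg γ (hω j)) ⟨i, Finset.mem_univ i, ?_⟩
  rw [weightPow_of_pos γ hi]
  positivity

lemma starWeights_pos_iff (γ : ℝ) {ω : Fin n → ℝ} (hω : ∀ i, 0 ≤ ω i) (hω' : ∃ i, 0 < ω i)
    (i : Fin n) : 0 < starWeights γ ω i ↔ 0 < ω i := by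
  rw [starWeights, div_pos_iff_of_pos_right (kappa_pos γ hω hω')]
  refine ⟨fun h => (hω i).lt_of_ne fun h0 => ?_, fun h => ?_⟩
  · rw [weightPow, if_pos h0.symm] at h
    exact h.false
  · rw [weightPow_of_pos γ h]
    positivity

lemma combinationTest_eq_one_iff {F : ℝ → ℝ} {γ : ℝ} {ω : Fin n → ℝ} {α : ℝ} {p : Fin n → ℝ} :
    combinationTest F γ ω α p = 1 ↔ quantile F (1 - α / kappa γ ω) < weightedSum F ω p := by
  rw [combinationTest]
  split_ifs with h <;> simp [h]

lemma bonferroniTest_eq_one_iff {w : Fin n → ℝ} {α : ℝ} {p : Fin n → ℝ} (hα : 0 < α)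
    (hp : ∀ i, 0 < p i) :
    bonferroniTest w α p = 1 ↔ ∃ i, 0 < w i ∧ p i < w i * α := by
  have h : bonferroniTest w α p = 1 ↔
      (⨅ i, ENNReal.ofReal (p i) / ENNReal.ofReal (w i)) < ENNReal.ofReal α := by
    rw [bonferroniTest]
    split_ifs with h <;> simp [h]
  rw [h, iInf_lt_iff]
  refine exists_congr fun i => ?_
  -- In `[0, ∞]` one has `0 / 0 = 0`, so zero weights are harmless only because the p-values are
  -- positive.
  rcases le_or_gt (w i) 0 with hw | hw
  · rw [ENNReal.ofReal_of_nonpos hw, ENNReal.div_zero (ENNReal.ofReal_pos.2 (hp i)).ne']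
    simp [hw.not_gt]
  · rw [← ENNReal.ofReal_div_of_pos hw, ENNReal.ofReal_lt_ofReal_iff hα, div_lt_iff₀ hw, mul_comm]
    simp [hw]

lemma combinationTest_ne_bonferroniTest_iff {F : ℝ → ℝ} {γ : ℝ} {ω w : Fin n → ℝ} {α : ℝ}
    {p : Fin n → ℝ} : combinationTest F γ ω α p ≠ bonferroniTest w α p ↔
      ¬ (combinationTest F γ ω α p = 1 ↔ bonferroniTest w α p = 1) := by
  unfold combinationTest bonferroniTest
  split_ifs <;> simp

lemma exists_lt_of_sum_erase_lt {f : Fin n → ℝ} {b : ℝ} (i : Fin n) (hb : 0 ≤ b)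
    (h : b < ∑ j ∈ Finset.univ.erase i, f j) : ∃ j, j ≠ i ∧ b / n < f j := by
  by_contra! hcon
  have hn : (0 : ℝ) < n := by exact_mod_cast Fin.pos i
  have h1 : ∑ j ∈ Finset.univ.erase i, f j ≤ ∑ j ∈ Finset.univ.erase i, b / n :=
    Finset.sum_le_sum fun j hj => hcon j (Finset.ne_of_mem_erase hj)
  have h2 : ∑ j ∈ Finset.univ.erase i, b / n ≤ ∑ _j : Fin n, b / n :=
    Finset.sum_le_sum_of_subset_of_nonneg (Finset.erase_subset _ _)
      fun _ _ _ => by positivity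
  have h3 : ∑ _j : Fin n, b / n = b := by
    rw [Finset.sum_const, Finset.card_univ, Fintype.card_fin, nsmul_eq_mul,
      mul_div_cancel₀ _ hn.ne']
  linarith

/-- If the two tests disagree at a small level, then either a p-value is close to its
Bonferroni threshold, or two p-values are simultaneously extreme. -/
lemma exists_eventually_of_ne {ν : Measure ℝ} [IsProbabilityMeasure ν] {γ : ℝ}
    (hF : RegularlyVaryingTail (cdf ν) γ) {ω : Fin n → ℝ} (hω : ∀ i, 0 ≤ ω i)
    (hω' : ∃ i, 0 < ω i) {ε : ℝ} (hε : 0 < ε) :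
    ∃ c C : ℝ, 0 < c ∧ 0 < C ∧ ∀ᶠ α : ℝ in 𝓝[>] 0, ∀ p : Fin n → ℝ,
      (∀ i, 0 < p i ∧ p i ≤ 1) →
      combinationTest (cdf ν) γ ω α p ≠ bonferroniTest (starWeights γ ω) α p →
      ∃ i, 0 < ω i ∧
        (((1 - ε) * (starWeights γ ω i * α) ≤ p i ∧ p i ≤ (1 + ε) * (starWeights γ ω i * α)) ∨
        ∃ j, i ≠ j ∧ ((p i ≤ C * α ∧ p j ≤ C * α) ∨ (p i < starWeights γ ω i * α ∧
          1 - cdf ν (-(c * quantile (cdf ν) (1 - α / kappa γ ω))) ≤ p j))) := by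
  have hκ := kappa_pos γ hω hω'
  obtain ⟨δ, hδ, hδ1, hδ2, hδ3⟩ := exists_rpow_near_one γ hε
  obtain ⟨k, hk⟩ := hω'
  have hn : (0 : ℝ) < n := by exact_mod_cast Fin.pos k
  set W := ∑ i, ω i with hW
  have hle : ∀ i, ω i ≤ W := fun i =>
    Finset.single_le_sum (fun j _ => hω j) (Finset.mem_univ i)
  have hWpos : 0 < W := hk.trans_le (hle k)
  -- Since `ω i ≤ W`, a term of modulus above `δx / (2n)` has a quantile of modulus above `c * x`,
  -- with the same `c` for every `i`.
  set c := δ / 2 / n / W with hc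
  have hcpos : 0 < c := by positivity
  have hcω : ∀ i, ω i * c ≤ δ / 2 / n := fun i => by
    rw [hc, mul_div_assoc', div_le_iff₀ hWpos, mul_comm]
    exact mul_le_mul_of_nonneg_left (hle i) (by positivity)
  obtain ⟨C, hC, hCle⟩ := hF.exists_tail_quantile_le hcpos
  have hdiv := tendsto_div_const_nhdsGT_zero hκ
  have hlow : ∀ᶠ a : ℝ in 𝓝[>] 0, ∀ i, 0 < ω i → ∀ p, 0 < p → p < (1 - ε) * (ω i ^ γ * a) →
      (1 + δ) * quantile (cdf ν) (1 - a) ≤ ω i * quantile (cdf ν) (1 - p) :=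
    eventually_all.2 fun i => by
      by_cases hi : 0 < ω i
      · exact (hF.eventually_le_mul_quantile hδ hδ1 hδ2 hi).mono fun a ha _ => ha
      · exact Eventually.of_forall fun a h => absurd h hi
  have hupp : ∀ᶠ a : ℝ in 𝓝[>] 0, ∀ i, 0 < ω i → ∀ p, p ≤ 1 → (1 + ε) * (ω i ^ γ * a) < p →
      ω i * quantile (cdf ν) (1 - p) ≤ (1 - δ) * quantile (cdf ν) (1 - a) :=
    eventually_all.2 fun i => by
      by_cases hi : 0 < ω i
      · exact (hF.eventually_mul_quantile_le hε hδ hδ1 hδ3 hi).mono fun a ha _ => ha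
      · exact Eventually.of_forall fun a h => absurd h hi
  refine ⟨c, C / kappa γ ω, hcpos, by positivity, ?_⟩
  filter_upwards [hdiv.eventually hlow, hdiv.eventually hupp, hdiv.eventually hCle,
    hdiv.eventually (hF.tendsto_quantile.eventually_gt_atTop 0), self_mem_nhdsWithin]
    with α hlow hupp hCle hx hα p hp hne
  have hα : 0 < α := hα
  have hstar : ∀ i, 0 < ω i → starWeights γ ω i * α = ω i ^ γ * (α / kappa γ ω) := fun i hi => by
    rw [starWeights, weightPow_of_pos γ hi]
    ring
  set x := quantile (cdf ν) (1 - α / kappa γ ω) with hxdef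
  set Y : Fin n → ℝ := fun i => ω i * quantile (cdf ν) (1 - p i) with hY
  have hpos : ∀ i, 0 < |Y i| → 0 < ω i := fun i hi => (hω i).lt_of_ne fun h0 => by
    rw [hY] at hi
    simp [← h0] at hi
  have hsum : weightedSum (cdf ν) ω p = ∑ i, Y i := rfl
  have hlarge : ∀ i, δ * x / 2 / n < Y i → p i ≤ C / kappa γ ω * α := by
    intro i hi
    have hY0 : 0 < Y i := lt_trans (by positivity) hi
    have hωi := hpos i (abs_pos.2 hY0.ne')
    have h1 : c * x < quantile (cdf ν) (1 - p i) := by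
      refine lt_of_mul_lt_mul_left ?_ hωi.le
      calc ω i * (c * x) = ω i * c * x := by ring
        _ ≤ δ / 2 / n * x := mul_le_mul_of_nonneg_right (hcω i) hx.le
        _ = δ * x / 2 / n := by ring
        _ < Y i := hi
    have h2 := lt_one_sub_cdf_of_lt_quantile (hp i).2 (by positivity) h1
    refine h2.le.trans (hCle.trans (le_of_eq ?_))
    ring
  rw [combinationTest_ne_bonferroniTest_iff, combinationTest_eq_one_iff,
    bonferroniTest_eq_one_iff hα fun i => (hp i).1, hsum] at hne
  have hsplit : ∀ i, ∑ j, Y j = Y i + ∑ j ∈ Finset.univ.erase i, Y j := fun i =>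
    (Finset.add_sum_erase _ _ (Finset.mem_univ i)).symm
  by_cases hS : x < ∑ i, Y i
  · have hbon : ∀ i, 0 < ω i → starWeights γ ω i * α ≤ p i := by
      intro i hi
      by_contra! h
      exact hne ⟨fun _ => ⟨i, (starWeights_pos_iff γ hω ⟨k, hk⟩ i).2 hi, h⟩, fun _ => hS⟩
    by_contra! hcon
    have hYle : ∀ i, Y i ≤ (1 - δ) * x := by
      intro i
      rcases (hω i).eq_or_lt with h0 | hi
      · have : Y i = 0 := by rw [hY]; simp [← h0]
        rw [this]
        exact mul_nonneg (by linarith) hx.le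
      · refine hupp i hi (p i) (hp i).2 ?_
        rw [← hstar i hi]
        have h1 := hbon i hi
        refine (hcon i hi).1 (le_trans ?_ h1)
        have h2 := (starWeights_pos_iff γ hω ⟨k, hk⟩ i).2 hi
        have h3 : 0 < starWeights γ ω i * α := by positivity
        nlinarith
    -- The sum exceeds `x` but no term exceeds `(1 - δ)x`. Hence some term is above `δx / (2n)`, and
    -- the others still sum to more than `δx`, so a second such term exists.
    obtain ⟨i, hi⟩ : ∃ i, δ * x / 2 / n < Y i := by
      by_contra! h
      have h1 : ∑ i, Y i ≤ ∑ _i : Fin n, δ * x / 2 / n := Finset.sum_le_sum fun i _ => h i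
      rw [Finset.sum_const, Finset.card_univ, Fintype.card_fin, nsmul_eq_mul,
        mul_div_cancel₀ _ hn.ne'] at h1
      nlinarith
    obtain ⟨j, hji, hj⟩ := exists_lt_of_sum_erase_lt (f := Y) (b := δ * x / 2) i (by positivity) (by
      have : 0 < δ * x := by positivity
      linarith [hsplit i, hYle i])
    have hωi := hpos i (abs_pos.2 (lt_trans (by positivity) hi).ne')
    exact absurd (hlarge j hj) (((hcon i hωi).2 j hji.symm).1 (hlarge i hi)).not_ge
  · obtain ⟨i, hwi, hpi⟩ : ∃ i, 0 < starWeights γ ω i ∧ p i < starWeights γ ω i * α := by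
      by_contra h
      exact hne ⟨fun h' => absurd h' hS, fun h' => absurd h' h⟩
    have hi := (starWeights_pos_iff γ hω ⟨k, hk⟩ i).1 hwi
    refine ⟨i, hi, ?_⟩
    rcases le_or_gt ((1 - ε) * (starWeights γ ω i * α)) (p i) with h | h
    · refine Or.inl ⟨h, hpi.le.trans ?_⟩
      have h3 : 0 < starWeights γ ω i * α := by positivity
      nlinarith
    · refine Or.inr ?_
      rw [hstar i hi] at h
      have h1 := hlow i hi (p i) (hp i).1 h
      -- Term `i` is at least `(1 + δ)x` while the total is at most `x`, so the others sum to at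
      -- most `-δx` and one of them is below `-δx / (2n)`.
      obtain ⟨j, hji, hj⟩ := exists_lt_of_sum_erase_lt (f := fun j => -Y j)
        (b := δ * x / 2) i (by positivity) (by
          rw [Finset.sum_neg_distrib]
          have : 0 < δ * x := by positivity
          linarith [hsplit i, not_lt.1 hS])
      have hωj := hpos j (abs_pos.2 (by
        have : 0 < δ * x / 2 / n := by positivity
        linarith))
      refine ⟨j, hji.symm, Or.inr ⟨hpi, one_sub_cdf_le_of_quantile_lt (hp j).1 ?_⟩⟩
      refine lt_of_mul_lt_mul_left ?_ hωj.le
      have h2 : ω j * (c * x) ≤ δ * x / 2 / n := by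
        calc ω j * (c * x) = ω j * c * x := by ring
          _ ≤ δ / 2 / n * x := mul_le_mul_of_nonneg_right (hcω j) hx.le
          _ = δ * x / 2 / n := by ring
      change Y j < ω j * -(c * x)
      linarith

/-! ### Assembling the union bound -/

lemma IsPairwiseNormalLaw.isNormalPair {μ : Fin n → ℝ} {ρ₀ : ℝ} {P : Measure (Fin n → ℝ)}
    (h : IsPairwiseNormalLaw μ ρ₀ P) {i j : Fin n} (hij : i ≠ j) :
    IsNormalPair P (fun t => t i) (fun t => t j) (μ i) (μ j) ρ₀ := by
  have hvar : ∀ i, Var[fun t : Fin n → ℝ => t i; P] = 1 := fun i => by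
    rw [← variance_id_map (measurable_pi_apply i).aemeasurable, h.marginal i, variance_id_gaussianReal]
    rfl
  refine ⟨⟨h.pair i j hij⟩, h.marginal i, h.marginal j, ?_⟩
  have := h.abs_correlation_le i j hij
  rwa [correlation, hvar, hvar, Real.sqrt_one, mul_one, div_one] at this

/-- With `e ≤ 1/2` one gets `B ≤ A + B/2`, and finiteness of `B` allows cancelling to `B ≤ 2A`.
Control relative to `B` alone thus suffices. -/
lemma div_min_le_of_le {D B A e θ : ℝ≥0∞} (hD : D ≤ e * B) (hB : B ≤ A + D) (hBtop : B ≠ ⊤)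
    (he : e ≤ 2⁻¹) (heθ : 2 * e ≤ θ) : D / min A B ≤ θ := by
  have hhalf : B ≤ 2 * A := by
    have h1 : D ≤ B / 2 := hD.trans (by rw [ENNReal.div_eq_inv_mul]; gcongr)
    have h2 : B / 2 + B / 2 ≤ A + B / 2 := by
      rw [ENNReal.add_halves]
      exact hB.trans (by gcongr)
    have h3 := (ENNReal.add_le_add_iff_right (ENNReal.div_ne_top hBtop two_ne_zero)).1 h2
    calc B = 2 * (B / 2) := (ENNReal.mul_div_cancel two_ne_zero ENNReal.ofNat_ne_top).symm
      _ ≤ 2 * A := by gcongr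
  refine ENNReal.div_le_of_le_mul ?_
  rcases min_choice A B with h | h <;> rw [h]
  · calc D ≤ e * (2 * A) := hD.trans (by gcongr)
      _ = 2 * e * A := by ring
      _ ≤ θ * A := by gcongr
  · refine hD.trans ?_
    gcongr
    exact le_trans (by rw [two_mul]; exact le_self_add) heθ

lemma measure_iUnion_union_iUnion_le {P : Measure (Fin n → ℝ)} {S : Fin n → Set (Fin n → ℝ)}
    {J O : Fin n → Fin n → Set (Fin n → ℝ)} {b : ℝ≥0∞} (hS : ∀ i, P (S i) ≤ b)
    (hJ : ∀ i j, P (J i j) ≤ b) (hO : ∀ i j, P (O i j) ≤ b) :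
    P (⋃ i, (S i ∪ ⋃ j, (J i j ∪ O i j))) ≤ n * (1 + n * 2) * b := by
  have h1 : ∀ i, P (S i ∪ ⋃ j, (J i j ∪ O i j)) ≤ (1 + n * 2) * b := fun i => by
    refine (measure_union_le _ _).trans ?_
    rw [add_mul, one_mul]
    refine add_le_add (hS i) ((measure_iUnion_fintype_le _ _).trans ?_)
    refine (Finset.sum_le_sum fun j _ => (measure_union_le _ _).trans
      (add_le_add (hJ i j) (hO i j))).trans ?_
    rw [Finset.sum_const, Finset.card_univ, Fintype.card_fin, nsmul_eq_mul, ← two_mul, mul_assoc]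
  refine (measure_iUnion_fintype_le _ _).trans ((Finset.sum_le_sum fun i _ => h1 i).trans ?_)
  rw [Finset.sum_const, Finset.card_univ, Fintype.card_fin, nsmul_eq_mul, mul_assoc]

/-- Asymptotic equivalence follows if, relative to the probability of exceeding a Bonferroni
threshold, the three kinds of exceptional events are negligible. -/
lemma asymptoticallyEquivalent_of_negligible {pval : ℝ → ℝ} (hmeas : Measurable pval)
    (hpval : ∀ t, 0 < pval t ∧ pval t ≤ 1) {ν : Measure ℝ} [IsProbabilityMeasure ν] {γ : ℝ}
    (hF : RegularlyVaryingTail (cdf ν) γ) {ω : Fin n → ℝ} (hω : ∀ i, 0 ≤ ω i)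
    (hω' : ∃ i, 0 < ω i) (μ : Fin n → ℝ) (ρ₀ : ℝ)
    (hshell : ∀ (m η : ℝ), 0 < η → ∃ ε₀ : ℝ, 0 < ε₀ ∧ ∀ ε, 0 < ε → ε ≤ ε₀ →
      ∀ᶠ a : ℝ in 𝓝[>] 0,
        gaussianReal m 1 {t | (1 - ε) * a ≤ pval t ∧ pval t ≤ (1 + ε) * a} ≤
          ENNReal.ofReal η * gaussianReal m 1 {t | pval t < a})
    (hjoint : ∀ (m₁ m₂ C η : ℝ), 0 < η → ∀ᶠ a : ℝ in 𝓝[>] 0,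
      ∀ (P : Measure (Fin n → ℝ)) (X Y : (Fin n → ℝ) → ℝ), IsNormalPair P X Y m₁ m₂ ρ₀ →
        P {t | pval (X t) ≤ C * a ∧ pval (Y t) ≤ C * a} ≤
          ENNReal.ofReal η * P {t | pval (X t) < a})
    (hopp : ∀ (m₁ m₂ c w η : ℝ), 0 < c → 0 < w → 0 < η → ∀ᶠ α : ℝ in 𝓝[>] 0,
      ∀ (P : Measure (Fin n → ℝ)) (X Y : (Fin n → ℝ) → ℝ), IsNormalPair P X Y m₁ m₂ ρ₀ →
        P {t | pval (X t) < w * α ∧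
          1 - cdf ν (-(c * quantile (cdf ν) (1 - α / kappa γ ω))) ≤ pval (Y t)} ≤
          ENNReal.ofReal η * P {t | pval (X t) < w * α}) :
    AsymptoticallyEquivalent pval (cdf ν) γ ω μ ρ₀ := by
  rw [AsymptoticallyEquivalent, ENNReal.tendsto_nhds_zero]
  intro θ hθ
  obtain ⟨r, hr0, hr, hrθ⟩ := ENNReal.lt_iff_exists_real_btwn.1 hθ
  rw [ENNReal.ofReal_pos] at hr
  have hn : (0 : ℝ) < n := by
    obtain ⟨k, -⟩ := hω'
    exact_mod_cast Fin.pos k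
  set e : ℝ := min (1 / 2) (r / 2) with he
  have hepos : 0 < e := by positivity
  -- The budget `e` is shared among `n` shells and `2n²` pair events.
  set η : ℝ := e / (n * (1 + n * 2)) with hη
  have hηpos : 0 < η := by positivity
  choose ε₀ hε₀ hshell' using fun i => hshell (μ i) η hηpos
  -- One `ε` for all indices is fixed first, because `c` and `C` depend on it.
  obtain ⟨ε, hε, hεle⟩ : ∃ ε : ℝ, 0 < ε ∧ ∀ i, ε ≤ ε₀ i := by
    obtain ⟨k, -⟩ := hω'
    have hne : (Finset.univ : Finset (Fin n)).Nonempty := ⟨k, Finset.mem_univ k⟩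
    exact ⟨Finset.univ.inf' hne ε₀, (Finset.lt_inf'_iff hne).2 fun i _ => hε₀ i,
      fun i => Finset.inf'_le _ (Finset.mem_univ i)⟩
  obtain ⟨c, C, hc, hC, hdet⟩ := exists_eventually_of_ne hF hω hω' hε
  set w := starWeights γ ω with hw
  have hwpos : ∀ i, 0 < ω i → 0 < w i := fun i => (starWeights_pos_iff γ hω hω' i).2
  have hS : ∀ᶠ α : ℝ in 𝓝[>] 0, ∀ i, 0 < ω i →
      gaussianReal (μ i) 1 {t | (1 - ε) * (w i * α) ≤ pval t ∧ pval t ≤ (1 + ε) * (w i * α)} ≤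
          ENNReal.ofReal η * gaussianReal (μ i) 1 {t | pval t < w i * α} :=
    eventually_all.2 fun i => by
      by_cases hi : 0 < ω i
      · exact ((tendsto_const_mul_nhdsGT_zero (hwpos i hi)).eventually
          (hshell' i ε hε (hεle i))).mono fun α h _ => h
      · exact Eventually.of_forall fun α h => absurd h hi
  have hJ : ∀ᶠ α : ℝ in 𝓝[>] 0, ∀ i j, 0 < ω i →
      ∀ (P : Measure (Fin n → ℝ)) (X Y : (Fin n → ℝ) → ℝ), IsNormalPair P X Y (μ i) (μ j) ρ₀ →
        P {t | pval (X t) ≤ C * α ∧ pval (Y t) ≤ C * α} ≤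
          ENNReal.ofReal η * P {t | pval (X t) < w i * α} :=
    eventually_all.2 fun i => eventually_all.2 fun j => by
      by_cases hi : 0 < ω i
      · refine ((tendsto_const_mul_nhdsGT_zero (hwpos i hi)).eventually
          (hjoint (μ i) (μ j) (C / w i) η hηpos)).mono fun α h _ => ?_
        rwa [← mul_assoc, div_mul_cancel₀ _ (hwpos i hi).ne'] at h
      · exact Eventually.of_forall fun α h => absurd h hi
  have hO : ∀ᶠ α : ℝ in 𝓝[>] 0, ∀ i j, 0 < ω i →
      ∀ (P : Measure (Fin n → ℝ)) (X Y : (Fin n → ℝ) → ℝ), IsNormalPair P X Y (μ i) (μ j) ρ₀ →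
        P {t | pval (X t) < w i * α ∧
          1 - cdf ν (-(c * quantile (cdf ν) (1 - α / kappa γ ω))) ≤ pval (Y t)} ≤
          ENNReal.ofReal η * P {t | pval (X t) < w i * α} :=
    eventually_all.2 fun i => eventually_all.2 fun j => by
      by_cases hi : 0 < ω i
      · exact (hopp (μ i) (μ j) c (w i) η hc (hwpos i hi) hηpos).mono fun α h _ => h
      · exact Eventually.of_forall fun α h => absurd h hi
  filter_upwards [hdet, hS, hJ, hO, self_mem_nhdsWithin] with α hdet hS hJ hO hα
  have hα : 0 < α := hα
  refine iSup₂_le fun P hP => ?_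
  have hP : IsPairwiseNormalLaw μ ρ₀ P := hP
  have hprob := hP.isProbabilityMeasure
  set D := {t : Fin n → ℝ | combinationTest (cdf ν) γ ω α (fun i => pval (t i)) ≠
    bonferroniTest w α (fun i => pval (t i))} with hDdef
  set A := {t : Fin n → ℝ | combinationTest (cdf ν) γ ω α (fun i => pval (t i)) = 1}
  set B := {t : Fin n → ℝ | bonferroniTest w α (fun i => pval (t i)) = 1}
  have hmarg : ∀ i, ∀ S : Set ℝ, MeasurableSet S →
      P {t | pval (t i) ∈ S} = gaussianReal (μ i) 1 {s | pval s ∈ S} := fun i S hS => by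
    rw [← hP.marginal i, Measure.map_apply (measurable_pi_apply i) (hmeas hS)]
    rfl
  have hBi : ∀ i, 0 < ω i → ENNReal.ofReal η * P {t | pval (t i) < w i * α} ≤
      ENNReal.ofReal η * P B := fun i hi => by
    gcongr
    intro t ht
    exact (bonferroniTest_eq_one_iff hα fun i => (hpval (t i)).1).2 ⟨i, hwpos i hi, ht⟩
  have hD : P D ≤ ENNReal.ofReal e * P B := by
    -- The index conditions sit inside the sets, so excluded indices contribute empty sets.
    have hsub : D ⊆ ⋃ i, ({t | 0 < ω i ∧ (1 - ε) * (w i * α) ≤ pval (t i) ∧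
          pval (t i) ≤ (1 + ε) * (w i * α)} ∪ ⋃ j,
        ({t | (0 < ω i ∧ i ≠ j) ∧ pval (t i) ≤ C * α ∧ pval (t j) ≤ C * α} ∪
        {t | (0 < ω i ∧ i ≠ j) ∧ pval (t i) < w i * α ∧
          1 - cdf ν (-(c * quantile (cdf ν) (1 - α / kappa γ ω))) ≤ pval (t j)})) := by
      intro t ht
      obtain ⟨i, hi, h⟩ := hdet (fun i => pval (t i)) (fun i => hpval (t i)) ht
      refine Set.mem_iUnion.2 ⟨i, ?_⟩
      rcases h with h | ⟨j, hij, h | h⟩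
      · exact Or.inl ⟨hi, h⟩
      · exact Or.inr (Set.mem_iUnion.2 ⟨j, Or.inl ⟨⟨hi, hij⟩, h⟩⟩)
      · exact Or.inr (Set.mem_iUnion.2 ⟨j, Or.inr ⟨⟨hi, hij⟩, h⟩⟩)
    refine (measure_mono hsub).trans ((measure_iUnion_union_iUnion_le
      (b := ENNReal.ofReal η * P B) (fun i => ?_) (fun i j => ?_) fun i j => ?_).trans
      (le_of_eq ?_))
    · by_cases hi : 0 < ω i
      · simp only [hi, true_and]
        refine le_trans ?_ (hBi i hi)
        have h1 := hmarg i (Set.Icc ((1 - ε) * (w i * α)) ((1 + ε) * (w i * α))) measurableSet_Icc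
        have h2 := hmarg i (Set.Iio (w i * α)) measurableSet_Iio
        simp only [Set.mem_Icc, Set.mem_Iio] at h1 h2
        rw [h1, h2]
        exact hS i hi
      · simp [hi]
    · by_cases hi : 0 < ω i ∧ i ≠ j
      · simp only [hi.1, hi.2, ne_eq, not_false_eq_true, true_and]
        exact (hJ i j hi.1 P _ _ (hP.isNormalPair hi.2)).trans (hBi i hi.1)
      · simp [hi]
    · by_cases hi : 0 < ω i ∧ i ≠ j
      · simp only [hi.1, hi.2, ne_eq, not_false_eq_true, true_and]
        exact (hO i j hi.1 P _ _ (hP.isNormalPair hi.2)).trans (hBi i hi.1)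
      · simp [hi]
    · have : ((n : ℝ≥0∞) * (1 + n * 2)) = ENNReal.ofReal (n * (1 + n * 2)) := by
        have h : (n * (1 + n * 2) : ℝ) = ((n * (1 + n * 2) : ℕ) : ℝ) := by push_cast; ring
        rw [h, ENNReal.ofReal_natCast]
        push_cast
        ring
      rw [this, ← mul_assoc, ← ENNReal.ofReal_mul (by positivity), hη,
        mul_div_cancel₀ _ (by positivity)]
  have hB : P B ≤ P A + P D := by
    refine (measure_mono fun t ht => ?_).trans (measure_union_le A D)
    by_cases h : t ∈ A
    · exact Or.inl h
    · exact Or.inr fun h' => h (h'.trans ht)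
  refine div_min_le_of_le hD hB (measure_ne_top _ _) ?_ ?_
  · rw [← ENNReal.ofReal_ofNat 2, ← ENNReal.ofReal_inv_of_pos two_pos]
    exact ENNReal.ofReal_le_ofReal ((min_le_left _ _).trans (by norm_num))
  · refine le_trans ?_ hrθ.le
    rw [← ENNReal.ofReal_ofNat 2, ← ENNReal.ofReal_mul two_pos.le]
    exact ENNReal.ofReal_le_ofReal (by linarith [min_le_right (1 / 2) (r / 2)])

/-! ### One-sided p-values -/

theorem asymptoticallyEquivalent_oneSidedPValue {ν : Measure ℝ} [IsProbabilityMeasure ν] {γ : ℝ}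
    (hF : RegularlyVaryingTail (cdf ν) γ) {ω : Fin n → ℝ} (hω : ∀ i, 0 ≤ ω i)
    (hω' : ∃ i, 0 < ω i) (μ : Fin n → ℝ) {ρ₀ : ℝ} (hρ₀ : ρ₀ < 1)
    (hbal : ∀ᶠ x : ℝ in atTop, cdf ν (-x) ≤ 1 - cdf ν x) :
    AsymptoticallyEquivalent oneSidedPValue (cdf ν) γ ω μ ρ₀ := by
  have hκ := kappa_pos γ hω hω'
  refine asymptoticallyEquivalent_of_negligible continuous_oneSidedPValue.measurable
    (fun t => ⟨oneSidedPValue_pos t, (oneSidedPValue_lt_one t).le⟩) hF hω hω' μ ρ₀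
    (fun m η => exists_gaussianReal_shell_le m)
    (fun m₁ m₂ C η => eventually_measure_joint_le _ m₁ m₂ hρ₀ C) ?_
  intro m₁ m₂ c w η hc hw hη
  obtain ⟨C, hC, hCle⟩ := hF.exists_tail_quantile_le hc
  set C' := max 1 (C / kappa γ ω / w)
  have hquant := (hF.tendsto_quantile.comp (tendsto_div_const_nhdsGT_zero hκ)).const_mul_atTop hc
  filter_upwards [(tendsto_div_const_nhdsGT_zero hκ).eventually hCle, hquant.eventually hbal,
    (tendsto_const_mul_nhdsGT_zero hw).eventually
      (eventually_measure_joint_le (Fin n → ℝ) m₁ (-m₂) hρ₀ C' hη), self_mem_nhdsWithin]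
    with α h1 h2 h3 hα P X Y hXY
  have hα : 0 < α := hα
  -- The p-value of `-Y` is at most `F(-cx)`, which tail balance bounds by the right tail at `cx`,
  -- of order `α`. Both `X` and `-Y` are then extreme.
  refine (measure_mono fun t ht => ?_).trans (h3 P X _ hXY.neg_right)
  refine ⟨ht.1.le.trans ?_, ?_⟩
  · exact le_mul_of_one_le_left (by positivity) (le_max_left _ _)
  · rw [oneSidedPValue_neg]
    have h4 := ht.2
    have h5 : C * (α / kappa γ ω) = C / kappa γ ω / w * (w * α) := by
      field_simp
    have h6 : C / kappa γ ω / w * (w * α) ≤ C' * (w * α) := by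
      gcongr
      exact le_max_right _ _
    simp only [Function.comp_apply] at h2
    linarith

/-! ### Two-sided p-values -/

lemma twoSidedPValue_eq (t : ℝ) : twoSidedPValue t = 2 * oneSidedPValue |t| := by
  rw [twoSidedPValue, oneSidedPValue]
  ring

lemma continuous_twoSidedPValue : Continuous twoSidedPValue := by
  simp_rw [funext twoSidedPValue_eq]
  exact continuous_const.mul (continuous_oneSidedPValue.comp continuous_abs)

lemma twoSidedPValue_mem (t : ℝ) : 0 < twoSidedPValue t ∧ twoSidedPValue t ≤ 1 := by
  rw [twoSidedPValue_eq]
  have h1 := oneSidedPValue_pos |t|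
  have h2 := strictAnti_oneSidedPValue.antitone (abs_nonneg t)
  rw [oneSidedPValue_zero] at h2
  constructor <;> linarith

lemma twoSidedPValue_neg (t : ℝ) : twoSidedPValue (-t) = twoSidedPValue t := by
  rw [twoSidedPValue_eq, twoSidedPValue_eq, abs_neg]

lemma twoSidedPValue_le (t : ℝ) : twoSidedPValue t ≤ 2 * oneSidedPValue t := by
  rw [twoSidedPValue_eq]
  have := strictAnti_oneSidedPValue.antitone (le_abs_self t)
  linarith

lemma twoSidedPValue_eq_or (t : ℝ) : twoSidedPValue t = 2 * oneSidedPValue t ∨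
    twoSidedPValue t = 2 * oneSidedPValue (-t) := by
  rw [twoSidedPValue_eq]
  rcases abs_choice t with h | h <;> simp [h]

/-- A two-sided shell at level `a` is covered by the one-sided shells of `T` and `-T` at level
`a/2`, each charged `η/2`. -/
lemma exists_gaussianReal_twoSidedPValue_shell_le (m : ℝ) {η : ℝ} (hη : 0 < η) :
    ∃ ε₀ : ℝ, 0 < ε₀ ∧ ∀ ε, 0 < ε → ε ≤ ε₀ → ∀ᶠ a : ℝ in 𝓝[>] 0,
      gaussianReal m 1 {t | (1 - ε) * a ≤ twoSidedPValue t ∧ twoSidedPValue t ≤ (1 + ε) * a} ≤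
        ENNReal.ofReal η * gaussianReal m 1 {t | twoSidedPValue t < a} := by
  obtain ⟨ε₁, hε₁, h₁⟩ := exists_gaussianReal_shell_le m (half_pos hη)
  obtain ⟨ε₂, hε₂, h₂⟩ := exists_gaussianReal_shell_le (-m) (half_pos hη)
  refine ⟨min ε₁ ε₂, lt_min hε₁ hε₂, fun ε hε hεle => ?_⟩
  filter_upwards [(tendsto_div_const_nhdsGT_zero two_pos).eventually
      (h₁ ε hε (hεle.trans (min_le_left _ _))),
    (tendsto_div_const_nhdsGT_zero two_pos).eventually
      (h₂ ε hε (hεle.trans (min_le_right _ _)))] with a h₁ h₂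
  have hneg : ∀ S : Set ℝ, MeasurableSet S →
      gaussianReal (-m) 1 {t | oneSidedPValue t ∈ S} =
        gaussianReal m 1 {t | oneSidedPValue (-t) ∈ S} := fun S hS => by
    rw [← gaussianReal_map_neg,
      Measure.map_apply measurable_neg (measurableSet_oneSidedPValue_mem hS)]
    rfl
  have hn1 := hneg (Set.Icc ((1 - ε) * (a / 2)) ((1 + ε) * (a / 2))) measurableSet_Icc
  have hn2 := hneg (Set.Iio (a / 2)) measurableSet_Iio
  simp only [Set.mem_Icc, Set.mem_Iio] at hn1 hn2
  rw [hn1, hn2] at h₂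
  have hle : gaussianReal m 1 {t | oneSidedPValue t < a / 2} ≤
      gaussianReal m 1 {t | twoSidedPValue t < a} := measure_mono fun t ht => by
    have ht : oneSidedPValue t < a / 2 := ht
    have := twoSidedPValue_le t
    change twoSidedPValue t < a
    linarith
  have hle' : gaussianReal m 1 {t | oneSidedPValue (-t) < a / 2} ≤
      gaussianReal m 1 {t | twoSidedPValue t < a} := measure_mono fun t ht => by
    have ht : oneSidedPValue (-t) < a / 2 := ht
    have := twoSidedPValue_le (-t)
    rw [twoSidedPValue_neg] at this
    change twoSidedPValue t < a
    linarith
  rw [← add_halves η, ENNReal.ofReal_add (half_pos hη).le (half_pos hη).le,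
    add_mul (ENNReal.ofReal _)]
  refine (measure_mono fun t ht => ?_).trans ((measure_union_le _ _).trans
    (add_le_add (h₁.trans (mul_le_mul_right hle _)) (h₂.trans (mul_le_mul_right hle' _))))
  obtain ⟨ht1, ht2⟩ := ht
  rcases twoSidedPValue_eq_or t with h | h <;> rw [h] at ht1 ht2
  · exact Or.inl ⟨by linarith, by linarith⟩
  · exact Or.inr ⟨by linarith, by linarith⟩

/-- The four sign choices for `(X, Y)` reduce to the one-sided bound at level `a/2`, each charged
`η/4`. -/
lemma eventually_measure_joint_twoSidedPValue_le (Ω : Type*) [MeasurableSpace Ω] (m₁ m₂ : ℝ)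
    {ρ₀ : ℝ} (hρ₀ : ρ₀ < 1) (C : ℝ) {η : ℝ} (hη : 0 < η) :
    ∀ᶠ a : ℝ in 𝓝[>] 0, ∀ (P : Measure Ω) (X Y : Ω → ℝ), IsNormalPair P X Y m₁ m₂ ρ₀ →
      P {ω | twoSidedPValue (X ω) ≤ C * a ∧ twoSidedPValue (Y ω) ≤ C * a} ≤
        ENNReal.ofReal η * P {ω | twoSidedPValue (X ω) < a} := by
  have h := fun m₁ m₂ => (tendsto_div_const_nhdsGT_zero two_pos).eventually
    (eventually_measure_joint_le Ω m₁ m₂ hρ₀ C (η := η / 4) (by positivity))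
  filter_upwards [h m₁ m₂, h m₁ (-m₂), h (-m₁) m₂, h (-m₁) (-m₂)] with a h1 h2 h3 h4 P X Y hXY
  have hle : P {ω | oneSidedPValue (X ω) < a / 2} ≤ P {ω | twoSidedPValue (X ω) < a} :=
    measure_mono fun ω hω => by
      have hω : oneSidedPValue (X ω) < a / 2 := hω
      have := twoSidedPValue_le (X ω)
      change twoSidedPValue (X ω) < a
      linarith
  have hle' : P {ω | oneSidedPValue (-X ω) < a / 2} ≤ P {ω | twoSidedPValue (X ω) < a} :=
    measure_mono fun ω hω => by
      have hω : oneSidedPValue (-X ω) < a / 2 := hω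
      have := twoSidedPValue_le (-X ω)
      rw [twoSidedPValue_neg] at this
      change twoSidedPValue (X ω) < a
      linarith
  have e1 := (h1 P _ _ hXY).trans (mul_le_mul_right hle _)
  have e2 := (h2 P _ _ hXY.neg_right).trans (mul_le_mul_right hle _)
  have e3 := (h3 P _ _ hXY.neg_left).trans (mul_le_mul_right hle' _)
  have e4 := (h4 P _ _ hXY.neg_left.neg_right).trans (mul_le_mul_right hle' _)
  have hsum : ENNReal.ofReal η = ENNReal.ofReal (η / 4) + ENNReal.ofReal (η / 4) +
      (ENNReal.ofReal (η / 4) + ENNReal.ofReal (η / 4)) := by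
    rw [← ENNReal.ofReal_add (by positivity) (by positivity),
      ← ENNReal.ofReal_add (by positivity) (by positivity)]
    congr 1
    ring
  rw [hsum, add_mul, add_mul]
  refine (measure_mono fun ω hω => ?_).trans ((measure_union_le _ _).trans
    (add_le_add ((measure_union_le _ _).trans (add_le_add e1 e2))
      ((measure_union_le _ _).trans (add_le_add e3 e4))))
  obtain ⟨hω1, hω2⟩ := hω
  rcases twoSidedPValue_eq_or (X ω) with h | h <;>
    rcases twoSidedPValue_eq_or (Y ω) with h' | h' <;> rw [h] at hω1 <;> rw [h'] at hω2
  · exact Or.inl (Or.inl ⟨by linarith, by linarith⟩)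
  · exact Or.inl (Or.inr ⟨by linarith, by linarith⟩)
  · exact Or.inr (Or.inl ⟨by linarith, by linarith⟩)
  · exact Or.inr (Or.inr ⟨by linarith, by linarith⟩)

theorem asymptoticallyEquivalent_twoSidedPValue {ν : Measure ℝ} [IsProbabilityMeasure ν] {γ : ℝ}
    (hF : RegularlyVaryingTail (cdf ν) γ) {ω : Fin n → ℝ} (hω : ∀ i, 0 ≤ ω i)
    (hω' : ∃ i, 0 < ω i) (μ : Fin n → ℝ) {ρ₀ : ℝ} (hρ₀ : 0 ≤ ρ₀) (hρ₀' : ρ₀ < 1) :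
    AsymptoticallyEquivalent twoSidedPValue (cdf ν) γ ω μ ρ₀ := by
  have hκ := kappa_pos γ hω hω'
  refine asymptoticallyEquivalent_of_negligible continuous_twoSidedPValue.measurable
    twoSidedPValue_mem hF hω hω' μ ρ₀
    (fun m η => exists_gaussianReal_twoSidedPValue_shell_le m)
    (fun m₁ m₂ C η => eventually_measure_joint_twoSidedPValue_le _ m₁ m₂ hρ₀' C) ?_
  intro m₁ m₂ c w η hc hw hη
  have hv : 0 < 1 - ρ₀ ^ 2 := by nlinarith
  -- This makes the small-ball factor `2ε / √(1 - ρ₀²)` equal to `η`.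
  set ε := η * √(1 - ρ₀ ^ 2) / 2 with hε
  have hεpos : 0 < ε := by positivity
  have hlt := strictAnti_oneSidedPValue hεpos
  rw [oneSidedPValue_zero] at hlt
  have hquant := (hF.tendsto_quantile.comp (tendsto_div_const_nhdsGT_zero hκ)).const_mul_atTop hc
  have hcdf := (tendsto_cdf_atBot ν).comp (tendsto_neg_atTop_atBot.comp hquant)
  -- Since `F(-cx) → 0` for any `F`, a p-value of at least `1 - F(-cx)` eventually forces `|Y| ≤ ε`,
  -- with no assumption on the left tail.
  filter_upwards [hcdf.eventually_lt_const (u := 1 - 2 * oneSidedPValue ε) (by linarith)]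
    with α hα P X Y hXY
  have hB : MeasurableSet {s | twoSidedPValue s < w * α} :=
    continuous_twoSidedPValue.measurable measurableSet_Iio
  refine (measure_mono fun t ht => ?_).trans
    ((hXY.measure_abs_le hρ₀' hB ε).trans (le_of_eq ?_))
  · refine ⟨ht.1, ?_⟩
    have h1 := ht.2
    rw [twoSidedPValue_eq] at h1
    simp only [Function.comp_apply] at hα
    exact (strictAnti_oneSidedPValue.lt_iff_gt.1
      (show oneSidedPValue ε < oneSidedPValue |Y t| by linarith)).le
  · rw [← ENNReal.ofReal_mul (by positivity)]
    congr 2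
    rw [hε]
    field_simp

end HeavyTail

theorem mainTheorem2 (n : ℕ) (ν : Measure ℝ) [IsProbabilityMeasure ν] (γ : ℝ)
    (hF : HeavyTail.RegularlyVaryingTail (cdf ν) γ)
    (ω : Fin n → ℝ) (hω : ∀ i, 0 ≤ ω i) (hω' : ∃ i, 0 < ω i)
    (μ : Fin n → ℝ) (ρ₀ : ℝ) (hρ₀ : 0 ≤ ρ₀) (hρ₀' : ρ₀ < 1) :
    HeavyTail.AsymptoticallyEquivalent HeavyTail.twoSidedPValue (cdf ν) γ ω μ ρ₀ ∧
    ((∀ᶠ x : ℝ in atTop, cdf ν (-x) ≤ 1 - cdf ν x) →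
      HeavyTail.AsymptoticallyEquivalent HeavyTail.oneSidedPValue (cdf ν) γ ω μ ρ₀) :=
  ⟨HeavyTail.asymptoticallyEquivalent_twoSidedPValue hF hω hω' μ hρ₀ hρ₀',
    HeavyTail.asymptoticallyEquivalent_oneSidedPValue hF hω hω' μ hρ₀'⟩
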